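/- Let $\mathbb{F}$ be a field and let $0\to\mathfrak{I}\to\mathfrak{L}\stackrel{\pi}{\to}\mathfrak{Q}\to 0$ be a short exact sequence of left Leibniz algebras over $\mathbb{F}$ (algebras, of arbitrary dimension, satisfying $x(yz)=(xy)z+y(xz)$) such that $\mathfrak{I}\subseteq C_\ell(\mathfrak{L}):=\{c\in\mathfrak{L}\mid cx=0\text{ for all }x\in\mathfrak{L}\}$. Then $\mathfrak{I}$ is an anti-symmetric $\mathfrak{Q}$-bimodule (i.e. with zero right action) via the well-defined actions $a\cdot y:=\pi^{-1}(a)y$ and $y\cdot a:=y\pi^{-1}(a)$ for $a\in\mathfrak{Q}$, $y\in\mathfrak{I}$. Moreover, for every $\mathfrak{Q}$-bimodule $M$, also viewed as an $\mathfrak{L}$-bimodule via $\pi$, there is a first quadrant cohomological spectral sequence (with differentials $d_r:E_r^{p,q}\to E_r^{p+r,q-r+1}$) with second term $$E_2^{p,q}\cong\begin{cases}\mathrm{HL}^{p}(\mathfrak{Q},\mathrm{Hom}_{\mathbb{F}}(\mathfrak{I},\mathrm{HL}^0(\mathfrak{L},M))_s)&\text{if }p\ge 0,\ q=0,\\ \mathrm{Hom}_{\mathbb{F}}(\mathrm{HL}_{p}(\mathfrak{Q},\mathfrak{I}_s),\mathrm{HL}^q(\mathfrak{L},M))&\text{if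 }p\ge 0,\ q\ge 1,\end{cases}$$ which converges to $\mathrm{HL}^\bullet(\mathfrak{L}|\mathfrak{Q},M)$: for every $n\ge 0$ there is a decreasing filtration $\mathrm{HL}^n(\mathfrak{L}|\mathfrak{Q},M)=F^0\supseteq F^1\supseteq\dots\supseteq F^{n+1}=0$ with $F^p/F^{p+1}\cong E_\infty^{p,n-p}$ for $0\le p\le n$. Here the following notation is used. * A left $\mathfrak{Q}$-module is a vector space $N$ with a bilinear left action such that $(xy)\cdot m=x\cdot(y\cdot m)-y\cdot(x\cdot m)$; a $\mathfrak{Q}$-bimodule is a left $\mathfrak{Q}$-module with a bilinear right action such that $(x\cdot m)\cdot y=x\cdot(m\cdot y)-m\cdot(xy)$ and $(m\cdot x)\cdot y=m\cdot(xy)-x\cdot(m\cdot y)$. For a left module $N$, $N_s$ is the symmetric bimodule with $m\cdot x:=-x\cdot m$. * $\mathrm{HL}^n(\mathfrak{L},M)$ is the $n$-th cohomology of $\mathrm{CL}^n(\mathfrak{L},M):=\mathrm{Hom}_{\mathbb{F}}(\mathfrak{L}^{\otimes n},M)$, $n\ge 0$, with $$(\mathrm{d}^nf)(x_1,\dots,x_{n+1})=\sum_{i=1}^{n}(-1)^{i+1}x_i\cdot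 f(x_1,\dots,\hat x_i,\dots,x_{n+1})+(-1)^{n+1}f(x_1,\dots,x_n)\cdot x_{n+1}+\sum_{1\le i<j\le n+1}(-1)^i f(x_1,\dots,\hat x_i,\dots,x_ix_j,\dots,x_{n+1}),$$ with $x_ix_j$ in the place of $x_j$. * $\mathrm{HL}^n(\mathfrak{L}|\mathfrak{Q},M)$ is the $n$-th cohomology of the complex with $n$-th term $\mathrm{Coker}(\mathrm{CL}^{n+1}(\mathfrak{Q},M)\to\mathrm{CL}^{n+1}(\mathfrak{L},M))$, the map being induced by $\pi$. * $\mathrm{HL}^0(\mathfrak{L},M)=\{m\in M\mid m\cdot x=0\text{ for all }x\in\mathfrak{L}\}$ is a left $\mathfrak{Q}$-module via the left action on $M$, and $\mathrm{Hom}_{\mathbb{F}}(\mathfrak{I},\mathrm{HL}^0(\mathfrak{L},M))$ is a left $\mathfrak{Q}$-module via $(x\cdot f)(y):=x\cdot f(y)-f(x\cdot y)$. * $\mathrm{HL}_n(\mathfrak{Q},\mathfrak{I}_s)$ is the $n$-th homology of the complex with $n$-th term $\mathfrak{Q}^{\otimes n}\otimes\mathfrak{I}$ and boundary $$x_1\otimes\dots\otimes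 x_{n+1}\otimes y\mapsto\sum_{i=1}^{n+1}(-1)^i x_1\otimes\cdots\hat x_i\cdots\otimes x_{n+1}\otimes x_i\cdot y+\sum_{1\le i<j\le n+1}(-1)^i x_1\otimes\cdots\hat x_i\cdots\otimes x_ix_j\otimes\cdots\otimes x_{n+1}\otimes y.$$ -/

import Mathlib

set_option linter.unusedSectionVars false

open scoped TensorProduct
open CategoryTheory

universe uF uI uL uQ uM uN

/-- A (not necessarily associative, not necessarily unital) algebra is a *left Leibniz algebra*
if every left multiplication operator is a derivation. -/
class IsLeftLeibniz (L : Type*) [NonUnitalNonAssocRing L] : Prop where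
  leibniz (x y z : L) : x * (y * z) = (x * y) * z + y * (x * z)

namespace Leibniz

/-! ### Left modules and bimodules -/

section Modules

variable (F : Type uF) [Field F]
variable (L : Type uL) [NonUnitalNonAssocRing L] [Module F L]

/-- The structure of a left `L`-module on the vector space `M`; `left x m` is `x · m`. -/
structure LeftModule (M : Type uM) [AddCommGroup M] [Module F M] where
  left : L →ₗ[F] M →ₗ[F] M
  left_mul (x y : L) (m : M) : left (x * y) m = left x (left y m) - left y (left x m)

/-- The structure of an `L`-bimodule on the vector space `M`; `left x m` is `x · m` and
`right x m` is `m · x`. -/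
structure Bimodule (M : Type uM) [AddCommGroup M] [Module F M] extends LeftModule F L M where
  right : L →ₗ[F] M →ₗ[F] M
  right_left (x y : L) (m : M) : right y (left x m) = left x (right y m) - right (x * y) m
  right_right (x y : L) (m : M) : right y (right x m) = right (x * y) m - left x (right y m)

variable {F L}
variable {M : Type uM} [AddCommGroup M] [Module F M] {N : Type uN} [AddCommGroup N] [Module F N]

/-- A bimodule is anti-symmetric if its right action is zero. -/
def Bimodule.IsAntisymmetric (B : Bimodule F L M) : Prop :=
  ∀ (x : L) (m : M), B.right x m = 0

/-- The symmetric bimodule `M_s` of a left module `M`: one puts `m · x := -(x · m)`. -/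
def LeftModule.symm (A : LeftModule F L M) : Bimodule F L M where
  toLeftModule := A
  right := -A.left
  right_left x y m := by simp [A.left_mul]; abel
  right_right x y m := by simp [A.left_mul]

/-- Transport of a left module structure along an isomorphism of vector spaces. -/
def LeftModule.transport (A : LeftModule F L M) (e : N ≃ₗ[F] M) : LeftModule F L N where
  left := LinearMap.mk₂ F (fun x n => e.symm (A.left x (e n)))
    (by simp) (by simp) (by simp) (by simp)
  left_mul x y n := by simp [A.left_mul]

/-- The left module `Hom(M, N)`, with `(x · f)(y) = x · f(y) - f(x · y)`. -/
def LeftModule.hom (A : LeftModule F L M) (C : LeftModule F L N) :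
    LeftModule F L (M →ₗ[F] N) where
  left := LinearMap.mk₂ F (fun x f => C.left x ∘ₗ f - f ∘ₗ A.left x)
    (by intros; ext; simp; abel) (by intros; ext; simp [smul_sub])
    (by intros; ext; simp; abel) (by intros; ext; simp [smul_sub])
  left_mul x y f := by ext; simp [A.left_mul, C.left_mul]; abel

variable {Q : Type uQ} [NonUnitalNonAssocRing Q] [Module F Q]

/-- The `L`-bimodule obtained from a `Q`-bimodule along a homomorphism `π : L → Q`. -/
def Bimodule.comap (B : Bimodule F Q M) (π : L →ₙₐ[F] Q) : Bimodule F L M where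
  left := B.left ∘ₗ (π : L →ₗ[F] Q)
  left_mul x y m := by simp [B.left_mul]
  right := B.right ∘ₗ (π : L →ₗ[F] Q)
  right_left x y m := by simp [B.right_left]
  right_right x y m := by simp [B.right_right]

@[simp] theorem Bimodule.comap_left (B : Bimodule F Q M) (π : L →ₙₐ[F] Q) (x : L) :
    (B.comap π).left x = B.left (π x) := rfl

@[simp] theorem Bimodule.comap_right (B : Bimodule F Q M) (π : L →ₙₐ[F] Q) (x : L) :
    (B.comap π).right x = B.right (π x) := rfl

/-- The space `M^L` of right invariants. -/
def Bimodule.rightInvariants (B : Bimodule F L M) : Submodule F M where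
  carrier := {m | ∀ x : L, B.right x m = 0}
  add_mem' ha hb x := by simp [ha x, hb x]
  zero_mem' x := by simp
  smul_mem' c m hm x := by simp [hm x]

/-- For a surjection `π : L → Q` and a `Q`-bimodule `M`, the left action of `Q` on `M` restricts to
the right `L`-invariants of `M`. -/
def Bimodule.invariantsLeftModule (B : Bimodule F Q M) (π : L →ₙₐ[F] Q)
    (hπ : Function.Surjective π) : LeftModule F Q (B.comap π).rightInvariants where
  left := LinearMap.mk₂ F
    (fun a m => ⟨B.left a m, fun x => by
      have h1 : B.right (π x) (m : M) = 0 := m.2 x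
      obtain ⟨z, hz⟩ := hπ (a * π x)
      have h2 : B.right (a * π x) (m : M) = 0 := by rw [← hz]; exact m.2 z
      simp [B.right_left, h1, h2]⟩)
    (by intros; ext; simp) (by intros; ext; simp) (by intros; ext; simp) (by intros; ext; simp)
  left_mul x y m := by ext; simp [B.left_mul]

end Modules

/-! ### Cohomology of a sequence of linear maps `C 0 → C 1 → ⋯` and homology of a sequence
`⋯ → C 1 → C 0` -/

section Homology

variable {F : Type uF} [Field F] {C : ℕ → Type uM} [∀ n, AddCommGroup (C n)] [∀ n, Module F (C n)]

/-- The coboundaries: the image of `d (n - 1)`, with `d (-1) = 0`. -/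
def coboundaries (d : ∀ n, C n →ₗ[F] C (n + 1)) : ∀ n, Submodule F (C n)
  | 0 => ⊥
  | n + 1 => LinearMap.range (d n)

/-- `ker (d n) / im (d (n - 1))`. -/
abbrev Cohomology (d : ∀ n, C n →ₗ[F] C (n + 1)) (n : ℕ) : Type uM :=
  LinearMap.ker (d n) ⧸ (coboundaries d n).submoduleOf (LinearMap.ker (d n))

/-- The cycles of a sequence of maps `b n : C (n + 1) → C n`; every element of `C 0` is a cycle. -/
def cycles (b : ∀ n, C (n + 1) →ₗ[F] C n) : ∀ n, Submodule F (C n)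
  | 0 => ⊤
  | n + 1 => LinearMap.ker (b n)

/-- Cycles modulo boundaries. -/
abbrev Homology (b : ∀ n, C (n + 1) →ₗ[F] C n) (n : ℕ) : Type uM :=
  cycles b n ⧸ (LinearMap.range (b n)).submoduleOf (cycles b n)

end Homology

/-! ### Leibniz cohomology -/

section Cochains

variable (F : Type uF) [Field F]
variable (L : Type uL) [NonUnitalNonAssocRing L] [Module F L]
variable (M : Type uM) [AddCommGroup M] [Module F M]

/-- The space `CL^n(L, M)` of `n`-linear maps `L × ⋯ × L → M`. -/
abbrev CL (n : ℕ) : Type (max uL uM) := MultilinearMap F (fun _ : Fin n => L) M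

variable {F L M}

/-- The cochain `(x_0, …, x_n) ↦ ρ(x_i) f(x_0, …, x̂_i, …, x_n)`. -/
def actionTerm (ρ : L →ₗ[F] M →ₗ[F] M) {n : ℕ} (i : Fin (n + 1)) :
    CL F L M n →ₗ[F] CL F L M (n + 1) where
  toFun f := LinearMap.uncurryMid i
    { toFun := fun x => (ρ x).compMultilinearMap f
      map_add' := by intros; ext; simp
      map_smul' := by intros; ext; simp }
  map_add' f g := by ext; simp
  map_smul' c f := by ext; simp

@[simp] theorem actionTerm_apply (ρ : L →ₗ[F] M →ₗ[F] M) {n : ℕ} (i : Fin (n + 1))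
    (f : CL F L M n) (x : Fin (n + 1) → L) :
    actionTerm ρ i f x = ρ (x i) (f (i.removeNth x)) := rfl

variable [IsScalarTower F L L] [SMulCommClass F L L]

/-- The cochain `(x_0, …, x_n) ↦ f(y_0, …, x_i y_j, …, y_{n-1})`, where `y` is the list obtained
from `x` by omitting `x_i`. For `i ≤ j` one has `y_j = x_{j+1}`. -/
def productTerm {n : ℕ} (i : Fin (n + 1)) (j : Fin n) : CL F L M n →ₗ[F] CL F L M (n + 1) where
  toFun f := LinearMap.uncurryMid i
    { toFun := fun x => MultilinearMap.mk'
        (fun m => f (Function.update m j (x * m j)))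
        (by
          intro m k a b
          rcases eq_or_ne k j with rfl | h
          · simp [mul_add]
          · simp [Function.update_of_ne h.symm, Function.update_comm h])
        (by
          intro m k c a
          rcases eq_or_ne k j with rfl | h
          · simp [mul_smul_comm]
          · simp [Function.update_of_ne h.symm, Function.update_comm h])
      map_add' := by intros; ext; simp [add_mul]
      map_smul' := by intros; ext; simp [smul_mul_assoc] }
  map_add' f g := by ext; simp
  map_smul' c f := by ext; simp

@[simp] theorem productTerm_apply {n : ℕ} (i : Fin (n + 1)) (j : Fin n)
    (f : CL F L M n) (x : Fin (n + 1) → L) :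
    productTerm i j f x =
      f (Function.update (i.removeNth x) j (x i * i.removeNth x j)) := rfl

/-- The Leibniz coboundary operator
`(d f)(x_1, …, x_{n+1}) = ∑_{1 ≤ i ≤ n} (-1)^(i+1) x_i · f(x_1, …, x̂_i, …, x_{n+1})`
`  + (-1)^(n+1) f(x_1, …, x_n) · x_{n+1}`
`  + ∑_{1 ≤ i < j ≤ n+1} (-1)^i f(x_1, …, x̂_i, …, x_i x_j, …, x_{n+1})`
(below, indices start from `0`). -/
noncomputable def coboundary (B : Bimodule F L M) (n : ℕ) : CL F L M n →ₗ[F] CL F L M (n + 1) :=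
  ∑ i : Fin n, (-1 : F) ^ (i : ℕ) • actionTerm B.left i.castSucc
    + (-1 : F) ^ (n + 1) • actionTerm B.right (Fin.last n)
    + ∑ i : Fin (n + 1), ∑ j : Fin n,
        if (i : ℕ) ≤ j then (-1 : F) ^ ((i : ℕ) + 1) • productTerm i j else 0

/-- The Leibniz cohomology `HL^n(L, M)`. -/
abbrev HL (B : Bimodule F L M) (n : ℕ) : Type (max uL uM) := Cohomology (coboundary B) n

theorem coboundary_apply (B : Bimodule F L M) {n : ℕ} (f : CL F L M n) (x : Fin (n + 1) → L) :
    coboundary B n f x =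
      ∑ i : Fin n, (-1 : F) ^ (i : ℕ) •
          B.left (x i.castSucc) (f (i.castSucc.removeNth x))
        + (-1 : F) ^ (n + 1) • B.right (x (Fin.last n)) (f ((Fin.last n).removeNth x))
        + ∑ i : Fin (n + 1), ∑ j : Fin n, if (i : ℕ) ≤ j then (-1 : F) ^ ((i : ℕ) + 1) •
            f (Function.update (i.removeNth x) j (x i * x j.succ)) else 0 := by
  have h : ∀ (i : Fin (n + 1)) (j : Fin n),
      (if (i : ℕ) ≤ j then (-1 : F) ^ ((i : ℕ) + 1) • productTerm (M := M) i j else 0) f x =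
      if (i : ℕ) ≤ j then (-1 : F) ^ ((i : ℕ) + 1) •
            f (Function.update (i.removeNth x) j (x i * x j.succ)) else 0 := by
    intro i j
    split_ifs with hij
    · have : i.succAbove j = j.succ := Fin.succAbove_of_le_castSucc _ _ hij
      simp [Fin.removeNth, this]
    · simp
  simp [coboundary, h]

theorem coboundary_zero_apply (B : Bimodule F L M) (f : CL F L M 0) (x : Fin 1 → L) :
    coboundary B 0 f x = -B.right (x 0) (f 0) := by
  rw [coboundary_apply]
  simp [Subsingleton.elim (Fin.removeNth 0 x) 0]

/-- The canonical identification of `HL^0(L, M)` with the space `M^L` of right invariants: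
the class of a `0`-cocycle is sent to its value. -/
noncomputable def HLzeroEquiv (B : Bimodule F L M) : HL B 0 ≃ₗ[F] B.rightInvariants :=
  (Submodule.quotEquivOfEqBot _ (by simp [coboundaries, Submodule.submoduleOf])).trans
    { toFun := fun f => ⟨(f : CL F L M 0) 0, fun x => by
        have h := coboundary_zero_apply B f (fun _ => x)
        rw [LinearMap.mem_ker.1 f.2] at h
        simpa using h.symm⟩
      map_add' := fun f g => rfl
      map_smul' := fun c f => rfl
      invFun := fun m => ⟨MultilinearMap.constOfIsEmpty F (fun _ : Fin 0 => L) (m : M), by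
        ext x
        rw [coboundary_zero_apply]
        simpa using m.2 (x 0)⟩
      left_inv := fun f => by
        ext x
        simp [Subsingleton.elim x 0]
      right_inv := fun m => by simp }

variable {Q : Type uQ} [NonUnitalNonAssocRing Q] [Module F Q]

/-- For a surjection `π : L → Q` and a `Q`-bimodule `M`, the left `Q`-module `HL^0(L, M) = M^L`. -/
noncomputable def HLzeroLeftModule (B : Bimodule F Q M) (π : L →ₙₐ[F] Q)
    (hπ : Function.Surjective π) : LeftModule F Q (HL (B.comap π) 0) :=
  (B.invariantsLeftModule π hπ).transport (HLzeroEquiv (B.comap π))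

variable [IsScalarTower F Q Q] [SMulCommClass F Q Q]

/-- The map `CL^n(Q, M) → CL^n(L, M)` induced by `π : L → Q`. -/
def pullback (π : L →ₙₐ[F] Q) (n : ℕ) : CL F Q M n →ₗ[F] CL F L M n where
  toFun f := f.compLinearMap fun _ => (π : L →ₗ[F] Q)
  map_add' _ _ := rfl
  map_smul' _ _ := rfl

@[simp] theorem pullback_apply (π : L →ₙₐ[F] Q) (n : ℕ) (f : CL F Q M n) (x : Fin n → L) :
    pullback π n f x = f fun i => π (x i) := rfl

theorem coboundary_pullback (B : Bimodule F Q M) (π : L →ₙₐ[F] Q) (n : ℕ) (f : CL F Q M n) :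
    coboundary (B.comap π) n (pullback π n f) = pullback π (n + 1) (coboundary B n f) := by
  ext x
  have h : ∀ (i : Fin (n + 1)) (j : Fin n),
      (fun k => π (Function.update (i.removeNth x) j (x i * x j.succ) k)) =
        Function.update (i.removeNth fun k => π (x k)) j (π (x i) * π (x j.succ)) := by
    intro i j
    ext k
    rcases eq_or_ne k j with rfl | hk
    · simp
    · simp [Function.update_of_ne hk, Fin.removeNth]
  simp only [coboundary_apply, pullback_apply, h]
  rfl

/-- The relative cochain complex: `CL^n(L|Q, M)` is the cokernel of
`CL^{n+1}(Q, M) → CL^{n+1}(L, M)`. The cokernel of `CL^0(Q, M) → CL^0(L, M)` is zero, so that no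
cochains of degree `-1` are left out. -/
abbrev relCL (M : Type uM) [AddCommGroup M] [Module F M] (π : L →ₙₐ[F] Q) (n : ℕ) :
    Type (max uL uM) :=
  CL F L M (n + 1) ⧸ LinearMap.range (pullback (M := M) π (n + 1))

/-- The coboundary of the relative complex, induced by that of `CL(L, M)`. -/
noncomputable def relCoboundary (B : Bimodule F Q M) (π : L →ₙₐ[F] Q) (n : ℕ) :
    relCL M π n →ₗ[F] relCL M π (n + 1) :=
  Submodule.mapQ _ _ (coboundary (B.comap π) (n + 1)) (by
    rintro _ ⟨f, rfl⟩
    exact ⟨coboundary B (n + 1) f, (coboundary_pullback B π (n + 1) f).symm⟩)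

/-- The relative cohomology `HL^n(L|Q, M)`. -/
abbrev relHL (B : Bimodule F Q M) (π : L →ₙₐ[F] Q) (n : ℕ) : Type (max uL uM) :=
  Cohomology (relCoboundary B π) n

end Cochains

/-! ### Leibniz homology -/

section Chains

variable (F : Type uF) [Field F]
variable (Q : Type uQ) [NonUnitalNonAssocRing Q] [Module F Q]
variable (A : Type uM) [AddCommGroup A] [Module F A]

/-- The space of chains `Q ⊗ ⋯ ⊗ Q ⊗ A` (`n` factors `Q`). -/
abbrev chains (n : ℕ) := (⨂[F] _ : Fin n, Q) ⊗[F] A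

/-- The `n`-linear map `(x_1, …, x_n) ↦ (a ↦ x_1 ⊗ ⋯ ⊗ x_n ⊗ a)`. -/
noncomputable def chainMk (n : ℕ) :
    MultilinearMap F (fun _ : Fin n => Q) (A →ₗ[F] chains F Q A n) :=
  (TensorProduct.mk F (⨂[F] _ : Fin n, Q) A).compMultilinearMap (PiTensorProduct.tprod F)

variable {F Q A}

@[simp] theorem chainMk_apply (n : ℕ) (x : Fin n → Q) (a : A) :
    chainMk F Q A n x a = PiTensorProduct.tprod F x ⊗ₜ[F] a := rfl

/-- The action `(x, g) ↦ g(x · -)` of `Q` on linear maps out of `A`. -/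
def precomp (S : LeftModule F Q A) (N : Type uN) [AddCommGroup N] [Module F N] :
    Q →ₗ[F] (A →ₗ[F] N) →ₗ[F] (A →ₗ[F] N) :=
  LinearMap.mk₂ F (fun x g => g ∘ₗ S.left x)
    (by intros; ext; simp) (by intros; ext; simp) (by intros; rfl) (by intros; rfl)

variable [IsScalarTower F Q Q] [SMulCommClass F Q Q]

/-- The Leibniz boundary operator with coefficients in the symmetric bimodule `A_s` of a left
module `A`:
`x_1 ⊗ ⋯ ⊗ x_{n+1} ⊗ a ↦ ∑_{1 ≤ i ≤ n+1} (-1)^i x_1 ⊗ ⋯ x̂_i ⋯ ⊗ x_{n+1} ⊗ (x_i · a)`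
`  + ∑_{1 ≤ i < j ≤ n+1} (-1)^i x_1 ⊗ ⋯ x̂_i ⋯ ⊗ x_i x_j ⊗ ⋯ ⊗ x_{n+1} ⊗ a`
(below, indices start from `0`). -/
noncomputable def boundary (S : LeftModule F Q A) (n : ℕ) :
    chains F Q A (n + 1) →ₗ[F] chains F Q A n :=
  TensorProduct.lift (PiTensorProduct.lift (R := F) (s := fun _ : Fin (n + 1) => Q)
    (∑ i : Fin (n + 1), (-1 : F) ^ ((i : ℕ) + 1) •
        actionTerm (precomp S (chains F Q A n)) i (chainMk F Q A n)
      + ∑ i : Fin (n + 1), ∑ j : Fin n,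
          if (i : ℕ) ≤ j then
            (-1 : F) ^ ((i : ℕ) + 1) •
              productTerm (M := A →ₗ[F] chains F Q A n) i j (chainMk F Q A n)
          else 0))

theorem boundary_tmul (S : LeftModule F Q A) (n : ℕ) (x : Fin (n + 1) → Q) (a : A) :
    boundary S n (PiTensorProduct.tprod F x ⊗ₜ[F] a) =
      ∑ i : Fin (n + 1), (-1 : F) ^ ((i : ℕ) + 1) •
          PiTensorProduct.tprod F (i.removeNth x) ⊗ₜ[F] S.left (x i) a
        + ∑ i : Fin (n + 1), ∑ j : Fin n, if (i : ℕ) ≤ j then (-1 : F) ^ ((i : ℕ) + 1) •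
            PiTensorProduct.tprod F (Function.update (i.removeNth x) j (x i * x j.succ)) ⊗ₜ[F] a
          else 0 := by
  have h : ∀ (i : Fin (n + 1)) (j : Fin n),
      ((if (i : ℕ) ≤ j then (-1 : F) ^ ((i : ℕ) + 1) • productTerm i j (chainMk F Q A n)
        else 0 : CL F Q (A →ₗ[F] chains F Q A n) (n + 1)) x) a =
      if (i : ℕ) ≤ j then (-1 : F) ^ ((i : ℕ) + 1) •
            PiTensorProduct.tprod F (Function.update (i.removeNth x) j (x i * x j.succ)) ⊗ₜ[F] a
          else 0 := by
    intro i j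
    split_ifs with hij
    · have : i.succAbove j = j.succ := Fin.succAbove_of_le_castSucc _ _ hij
      simp [Fin.removeNth, this]
    · simp
  simp [boundary, h, precomp, LinearMap.sum_apply]

/-- The Leibniz homology `HL_n(Q, A_s)`. -/
abbrev HLhomology (S : LeftModule F Q A) (n : ℕ) := Homology (boundary S) n

end Chains

/-! ### Convergence of spectral sequences -/

section Convergence

universe w v

variable {F : Type uF} [Field F]

/-- A first quadrant cohomological spectral sequence `E` *converges* to the graded vector space `H`
if each `H n` has a decreasing filtration `H n = Fil^0 ⊇ Fil^1 ⊇ ⋯ ⊇ Fil^{n+1} = 0` with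
`E_∞^{p,q} ≅ Fil^p (H (p+q)) / Fil^{p+1} (H (p+q))`. Here `E_∞^{p,q}` is the term `E_r^{p,q}` for
any `r > max (p, q + 1)`: from there on all differentials to and from the position `(p, q)`
vanish, as they come from, or lead to, positions outside the first quadrant. -/
def ConvergesTo (E : E₂CohomologicalSpectralSequenceNat (ModuleCat.{w} F))
    (H : ℕ → Type v) [∀ n, AddCommGroup (H n)] [∀ n, Module F (H n)] : Prop :=
  ∃ Fil : ∀ n : ℕ, ℕ → Submodule F (H n),
    (∀ n, Antitone (Fil n)) ∧ (∀ n, Fil n 0 = ⊤) ∧ (∀ n, Fil n (n + 1) = ⊥) ∧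
    ∀ (p q : ℕ) (r : ℤ) (hr : 2 ≤ r), (p : ℤ) < r → (q : ℤ) + 1 < r →
      Nonempty ((E.page r hr).X (p, q) ≃ₗ[F]
        (Fil (p + q) p ⧸ (Fil (p + q) (p + 1)).submoduleOf (Fil (p + q) p)))

end Convergence

end Leibniz

/-!
The spectral sequence is that of the complex `CL(L, M)`, filtered by the number of leading
arguments which factor through `Q`. Write `J` for the image of `I` in `L`. A cochain belongs to the
`p`-th step `filt M J p` if it vanishes as soon as one of its first `p` arguments lies in `J`. As
`J` is a left central ideal acting trivially on `M`, these are subcomplexes (`dTot_mem`). In degree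
`n` the `n`-th step consists of the cochains induced from `Q` (`inDegree_mem_negligible_iff`), and
dividing them out gives the relative complex, on which the filtration is finite in each degree.
The spectral sequence of a filtered complex and its convergence are developed directly from
`E_r^p = Z_r^p / (F^{p+1} + d F^{p-r+1} ∩ F^p)` (`FilteredDifferential.spectralSequence`,
`FilteredDifferential.convergesTo`).

A cochain `f` in the `p`-th step, of degree `q + 1 + p`, is determined modulo the next step by its
values `f(s a_1, …, s a_p, ι y, -)`, where `s` is a linear section of `π`. These are cochains of
degree `q` of `L`; they are cocycles if `d f` lies in the step `p + 1`, and their classes form the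
*symbol* of `f`, a multilinear map `Q × ⋯ × Q → Hom(I, HL^q(L, M))`. The symbol identifies the first
page with `CL^p(Q, Hom(I, HL^q(L, M)))` (`symbol_ofSymbol`, `sub_dTot_primitive_mem`,
`symbol_dTot_eq_zero`) and its differential with the Leibniz coboundary for the symmetric bimodule
`Hom(I, HL^q(L, M))_s` (`symbol_dTot`). All of this goes by induction on `p`, stripping off the first
argument by means of Cartan's formula `i_x d + d i_x = θ_x` (`curryLeft_coboundary`).

Hence `E_2^{p,q} = HL^p(Q, Hom(I, HL^q(L, M))_s)` for all `q`. For `q ≥ 1` Cartan's formula shows that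
`L` acts trivially on `HL^q(L, M)` (`mk_lieDer_eq_zero`), so that the complex is the dual of the
complex computing `HL_•(Q, I_s)`; as the ground field is a field, its cohomology is
`Hom(HL_p(Q, I_s), HL^q(L, M))` (`nonempty_HL_trivial_equiv`).
-/

namespace Leibniz

/-! ### Cartan calculus on Leibniz cochains -/

section Cartan

variable {F : Type uF} [Field F]
variable {L : Type uL} [NonUnitalNonAssocRing L] [Module F L]
variable {M : Type uM} [AddCommGroup M] [Module F M]

theorem curryLeft_injective {n : ℕ} {f g : CL F L M (n + 1)}
    (h : ∀ x, f.curryLeft x = g.curryLeft x) : f = g :=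
  (multilinearCurryLeftEquiv F (fun _ : Fin (n + 1) => L) M).injective (LinearMap.ext h)

theorem curryLeft_add {n : ℕ} (f g : CL F L M (n + 1)) (x : L) :
    (f + g).curryLeft x = f.curryLeft x + g.curryLeft x := rfl

theorem curryLeft_sub {n : ℕ} (f g : CL F L M (n + 1)) (x : L) :
    (f - g).curryLeft x = f.curryLeft x - g.curryLeft x := rfl

variable [IsScalarTower F L L] [SMulCommClass F L L]

/-- The Lie derivative `θ_x`:
`(θ_x f)(x_1, …, x_n) = x · f(x_1, …, x_n) - ∑_j f(x_1, …, x x_j, …, x_n)`.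
It is assembled from the terms of the Leibniz coboundary in which the first argument acts. -/
def lieDer (A : LeftModule F L M) (n : ℕ) : L →ₗ[F] CL F L M n →ₗ[F] CL F L M n :=
  LinearMap.mk₂ F
    (fun x f => (actionTerm A.left 0 f - ∑ j : Fin n, productTerm 0 j f).curryLeft x)
    (by intros; simp) (by intros; simp)
    (by intros; rw [← curryLeft_add]; congr 1
        simp only [map_add, Finset.sum_add_distrib, add_sub_add_comm])
    (by
      intro c x f
      have : actionTerm A.left 0 (c • f) - ∑ j : Fin n, productTerm 0 j (c • f) =
        c • (actionTerm A.left 0 f - ∑ j : Fin n, productTerm 0 j f) := by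
        simp [smul_sub, Finset.smul_sum]
      rw [this]; rfl)

theorem lieDer_apply (A : LeftModule F L M) {n : ℕ} (x : L) (f : CL F L M n) (v : Fin n → L) :
    lieDer A n x f v =
      A.left x (f v) - ∑ j : Fin n, f (Function.update v j (x * v j)) := by
  simp [lieDer]

/-- The commutation rule `i_y ∘ θ_x = θ_x ∘ i_y - i_{xy}`. -/
theorem curryLeft_lieDer (A : LeftModule F L M) {n : ℕ} (x y : L) (f : CL F L M (n + 1)) :
    (lieDer A (n + 1) x f).curryLeft y =
      lieDer A n x (f.curryLeft y) - f.curryLeft (x * y) := by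
  ext v
  simp only [MultilinearMap.curryLeft_apply, lieDer_apply, sub_apply,
    Fin.sum_univ_succ, Fin.cons_zero, Fin.cons_succ, Fin.update_cons_zero, ← Fin.cons_update]
  abel

/-- Cartan's formula `i_x ∘ d + d ∘ i_x = θ_x` in positive degrees, `i_x` being the insertion of
`x` as first argument. -/
theorem curryLeft_coboundary (B : Bimodule F L M) {n : ℕ} (f : CL F L M (n + 1)) (x : L) :
    (coboundary B (n + 1) f).curryLeft x =
      lieDer B.toLeftModule (n + 1) x f - coboundary B n (f.curryLeft x) := by
  ext v
  have h (i : Fin (n + 1)) :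
      i.succ.removeNth (α := fun _ => L) (Fin.cons x v) = Fin.cons x (i.removeNth v) := by
    funext k
    refine Fin.cases ?_ (fun k => ?_) k
    · simp [Fin.removeNth]
    · simp [Fin.removeNth]
  have h0 (w : Fin (n + 2) → L) :
      Fin.removeNth (α := fun _ => L) 0 w = fun k => w k.succ := rfl
  have e1 : ∑ i : Fin (n + 1), (-1 : F) ^ (i : ℕ) • B.left ((Fin.cons x v : Fin (n + 2) → L)
        i.castSucc) (f (i.castSucc.removeNth (α := fun _ => L) (Fin.cons x v))) =
      B.left x (f v) - ∑ i : Fin n, (-1 : F) ^ (i : ℕ) •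
        B.left (v i.castSucc) (f (Fin.cons x (i.castSucc.removeNth v))) := by
    rw [Fin.sum_univ_succ]
    simp only [Fin.castSucc_zero, h0, Fin.cons_zero, Fin.cons_succ, ← Fin.succ_castSucc, h,
      Fin.val_succ, Fin.val_zero, pow_succ, pow_zero]
    simp [Finset.sum_neg_distrib, sub_eq_add_neg]
  have e2 : ∑ i : Fin (n + 2), ∑ j : Fin (n + 1), (if (i : ℕ) ≤ j then (-1 : F) ^ ((i : ℕ) + 1) •
        f (Function.update (i.removeNth (α := fun _ => L) (Fin.cons x v)) j
          ((Fin.cons x v : Fin (n + 2) → L) i * (Fin.cons x v : Fin (n + 2) → L) j.succ))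
        else 0) =
      - ∑ j : Fin (n + 1), f (Function.update v j (x * v j)) -
        ∑ i : Fin (n + 1), ∑ j : Fin n, if (i : ℕ) ≤ j then (-1 : F) ^ ((i : ℕ) + 1) •
          f (Fin.cons x (Function.update (i.removeNth v) j (v i * v j.succ))) else 0 := by
    rw [Fin.sum_univ_succ, sub_eq_add_neg, ← Finset.sum_neg_distrib, ← Finset.sum_neg_distrib]
    congr 1
    · refine Finset.sum_congr rfl fun j _ => ?_
      simp [h0]
    · refine Finset.sum_congr rfl fun i _ => ?_
      rw [Fin.sum_univ_succ, ← Finset.sum_neg_distrib]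
      simp only [Fin.val_succ, Fin.val_zero, h, Fin.cons_succ, ← Fin.cons_update]
      simp only [pow_succ, nonpos_iff_eq_zero, Nat.add_eq_zero_iff, one_ne_zero, and_false, if_false,
        zero_add, add_le_add_iff_right]
      refine Finset.sum_congr rfl fun j _ => ?_
      split_ifs <;> simp
  simp only [MultilinearMap.curryLeft_apply, sub_apply, lieDer_apply, coboundary_apply, e1, e2]
  rw [← Fin.succ_last, h, Fin.cons_succ, pow_succ _ (n + 1)]
  simp
  abel

theorem curryLeft_coboundary_zero (B : Bimodule F L M) (f : CL F L M 0) (x : L) (v : Fin 0 → L) :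
    (coboundary B 0 f).curryLeft x v = -B.right x (f v) := by
  rw [MultilinearMap.curryLeft_apply, coboundary_zero_apply, Fin.cons_zero,
    Subsingleton.elim v 0]

theorem lieDer_zero_apply (A : LeftModule F L M) (x : L) (f : CL F L M 0) (v : Fin 0 → L) :
    lieDer A 0 x f v = A.left x (f v) := by
  simp [lieDer_apply]

variable [IsLeftLeibniz L]

/-- The Lie derivatives define a left module structure on the cochains. -/
theorem lieDer_mul (A : LeftModule F L M) (n : ℕ) (x y : L) (f : CL F L M n) :
    lieDer A n (x * y) f = lieDer A n x (lieDer A n y f) - lieDer A n y (lieDer A n x f) := by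
  induction n generalizing x y with
  | zero =>
    ext v
    simp [lieDer_zero_apply, A.left_mul]
  | succ n ih =>
    refine curryLeft_injective fun z => ?_
    simp only [curryLeft_sub, curryLeft_lieDer, map_sub, ih, IsLeftLeibniz.leibniz x y z]
    have h : f.curryLeft (x * y * z + y * (x * z)) =
      f.curryLeft (x * y * z) + f.curryLeft (y * (x * z)) := map_add _ _ _
    rw [h]
    abel

theorem lieDer_coboundary (B : Bimodule F L M) (n : ℕ) (x : L) (f : CL F L M n) :
    lieDer B.toLeftModule (n + 1) x (coboundary B n f) =
      coboundary B n (lieDer B.toLeftModule n x f) := by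
  induction n generalizing x with
  | zero =>
    refine curryLeft_injective fun y => ?_
    ext v
    rw [curryLeft_lieDer]
    simp only [sub_apply, lieDer_zero_apply, curryLeft_coboundary_zero, B.right_left]
    simp only [map_neg]
    abel
  | succ n ih =>
    refine curryLeft_injective fun y => ?_
    have h := lieDer_mul B.toLeftModule (n + 1) x y f
    simp only [curryLeft_lieDer, curryLeft_coboundary, map_sub, ih, h]
    abel

/-- The Leibniz coboundary squares to zero. -/
theorem coboundary_coboundary (B : Bimodule F L M) (n : ℕ) (f : CL F L M n) :
    coboundary B (n + 1) (coboundary B n f) = 0 := by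
  induction n with
  | zero =>
    refine curryLeft_injective fun x => curryLeft_injective fun y => ?_
    rw [curryLeft_coboundary, curryLeft_sub, curryLeft_lieDer]
    ext v
    simp only [sub_apply, lieDer_zero_apply, curryLeft_coboundary_zero]
    simp [B.right_right]
    abel
  | succ n ih =>
    refine curryLeft_injective fun x => ?_
    rw [curryLeft_coboundary, curryLeft_coboundary, lieDer_coboundary, map_sub, ih]
    simp
    rfl

end Cartan
/-! ### The spectral sequence of a filtered differential module -/

section Auxiliary

variable {F : Type*} [Field F] {V A B : Type*} [AddCommGroup V] [Module F V]
  [AddCommGroup A] [Module F A] [AddCommGroup B] [Module F B]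

/-- Two quotients of the same space by the same subspace are isomorphic. -/
theorem nonempty_equiv_of_surjective (f : V →ₗ[F] A) (g : V →ₗ[F] B)
    (hf : Function.Surjective f) (hg : Function.Surjective g) (h : ∀ v, f v = 0 ↔ g v = 0) :
    Nonempty (A ≃ₗ[F] B) := by
  have hk : LinearMap.ker f = LinearMap.ker g := by
    ext v
    exact h v
  exact ⟨(f.quotKerEquivOfSurjective hf).symm.trans
    ((Submodule.quotEquivOfEq _ _ hk).trans (g.quotKerEquivOfSurjective hg))⟩

end Auxiliary

/-- A vector space `T` with a differential `D`, and subspaces `G p n`, to be thought of as the `p`-th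
step of a decreasing filtration on the part of degree `n`. The grading is only remembered through
these subspaces. The filtration is exhausted at `p = 0`, and is zero in degree `n` from
`p = n + 1` on; in particular `G p n = 0` for `n < 0`. -/
structure FilteredDifferential (F : Type*) [Field F] (T : Type*) [AddCommGroup T] [Module F T] where
  D : T →ₗ[F] T
  D_D (x : T) : D (D x) = 0
  G : ℤ → ℤ → Submodule F T
  anti {p p' : ℤ} (n : ℤ) (h : p ≤ p') : G p' n ≤ G p n
  D_mem {p n : ℤ} {x : T} (hx : x ∈ G p n) : D x ∈ G p (n + 1)
  eq_of_nonpos {p : ℤ} (n : ℤ) (h : p ≤ 0) : G p n = G 0 n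
  eq_bot {p n : ℤ} (h : n < p) : G p n = ⊥

namespace FilteredDifferential

variable {F : Type uF} [Field F] {T : Type uM} [AddCommGroup T] [Module F T]
variable (S : FilteredDifferential F T)

/-- The elements of filtration degree `p` whose differential has filtration degree `p + r`. -/
def Z (r p n : ℤ) : Submodule F T := S.G p n ⊓ (S.G (p + r) (n + 1)).comap S.D

/-- The subspace by which `Z r p n` has to be divided on the `r`-th page: elements of filtration
degree `p + 1`, and differentials of elements of filtration degree `p - r + 1`. -/
def N (r p n : ℤ) : Submodule F T := S.G (p + 1) n ⊔ ((S.G (p - r + 1) (n - 1)).map S.D ⊓ S.G p n)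

/-- The term `E_r^{p,n-p}`. -/
abbrev Page (r p n : ℤ) : Type uM := S.Z r p n ⧸ (S.N r p n).submoduleOf (S.Z r p n)

variable {S} {r p n : ℤ} {x : T}

theorem mem_cast {p' n' : ℤ} (hx : x ∈ S.G p n) (hp : p = p' := by lia)
    (hn : n = n' := by lia) : x ∈ S.G p' n' := hp ▸ hn ▸ hx

theorem mem_of_le {p' n' : ℤ} (hx : x ∈ S.G p n) (hp : p' ≤ p := by lia)
    (hn : n = n' := by lia) : x ∈ S.G p' n' := hn ▸ S.anti n hp hx

theorem mem_Z : x ∈ S.Z r p n ↔ x ∈ S.G p n ∧ S.D x ∈ S.G (p + r) (n + 1) := Iff.rfl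

theorem mem_N : x ∈ S.N r p n ↔ ∃ u ∈ S.G (p + 1) n, ∃ w ∈ S.G (p - r + 1) (n - 1),
    S.D w ∈ S.G p n ∧ u + S.D w = x := by
  simp only [N, Submodule.mem_sup, Submodule.mem_inf, Submodule.mem_map]
  constructor
  · rintro ⟨u, hu, _, ⟨⟨w, hw, rfl⟩, hw'⟩, rfl⟩
    exact ⟨u, hu, w, hw, hw', rfl⟩
  · rintro ⟨u, hu, w, hw, hw', rfl⟩
    exact ⟨u, hu, _, ⟨⟨w, hw, rfl⟩, hw'⟩, rfl⟩

theorem Z_succ_le (r p n : ℤ) : S.Z (r + 1) p n ≤ S.Z r p n := fun _ hx =>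
  ⟨hx.1, mem_of_le (mem_Z.1 hx).2⟩

theorem N_le_succ (r p n : ℤ) : S.N r p n ≤ S.N (r + 1) p n := fun x hx => by
  obtain ⟨u, hu, w, hw, hw', rfl⟩ := mem_N.1 hx
  exact mem_N.2 ⟨u, hu, w, mem_of_le hw, hw', rfl⟩

theorem D_mem_Z {p' n' : ℤ} (hp : p + r = p') (hn : n + 1 = n') (hx : x ∈ S.Z r p n) :
    S.D x ∈ S.Z r p' n' := by
  subst hp hn
  refine ⟨hx.2, ?_⟩
  simp [S.D_D]

theorem D_mem_N {p' n' : ℤ} (hp : p + r = p') (hn : n + 1 = n') (hx : x ∈ S.N r p n)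
    (hx' : x ∈ S.Z r p n) : S.D x ∈ S.N r p' n' := by
  subst hp hn
  obtain ⟨u, hu, w, hw, hw', rfl⟩ := mem_N.1 hx
  refine mem_N.2 ⟨0, zero_mem _, u, mem_cast hu, ?_, by simp [S.D_D]⟩
  simpa [S.D_D] using hx'.2

variable (S) in
/-- The differential of the `r`-th page. -/
def dPage (r : ℤ) {p n p' n' : ℤ} (hp : p + r = p') (hn : n + 1 = n') :
    S.Page r p n →ₗ[F] S.Page r p' n' :=
  Submodule.mapQ _ _ (S.D.restrict fun _ => D_mem_Z hp hn) 
    (show _ ≤ Submodule.comap _ _ from fun x hx => D_mem_N hp hn hx x.2)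

theorem dPage_mk {p' n' : ℤ} (hp : p + r = p') (hn : n + 1 = n') (x : S.Z r p n) :
    S.dPage r hp hn (Submodule.Quotient.mk x) =
      Submodule.Quotient.mk ⟨S.D x, D_mem_Z hp hn x.2⟩ := rfl

theorem mk_eq_zero_iff (x : S.Z r p n) :
    (Submodule.Quotient.mk x : S.Page r p n) = 0 ↔ (x : T) ∈ S.N r p n := by
  rw [Submodule.Quotient.mk_eq_zero]
  rfl

/-- The cycles of the `r`-th page are the classes of the elements of `Z_{r+1}`. -/
theorem dPage_mk_eq_zero_iff {p' n' : ℤ} (hp : p + r = p') (hn : n + 1 = n')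
    (x : S.Z r p n) : S.dPage r hp hn (Submodule.Quotient.mk x) = 0 ↔
      ∃ z ∈ S.Z (r + 1) p n, (x : T) - z ∈ S.N r p n := by
  subst hp hn
  rw [dPage_mk, mk_eq_zero_iff]
  constructor
  · intro h
    obtain ⟨u, hu, w, hw, hw', h⟩ := mem_N.1 h
    replace h : u + S.D w = S.D x := h
    -- The representative `x` is corrected by the element `w` of higher filtration degree.
    have hw1 : w ∈ S.G (p + 1) n := mem_cast hw
    refine ⟨x - w, mem_Z.2 ⟨sub_mem x.2.1 (mem_of_le hw), ?_⟩, ?_⟩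
    · rw [map_sub, ← h, add_sub_cancel_right]
      exact mem_cast hu
    · rw [sub_sub_cancel]
      exact Submodule.mem_sup_left hw1
  · rintro ⟨z, hz, h⟩
    obtain ⟨u, hu, w, hw, hw', h⟩ := mem_N.1 h
    have h2 : S.D x = S.D z + S.D u := by
      have := congrArg S.D h
      rw [map_add, S.D_D, add_zero, map_sub] at this
      rw [this]
      abel
    have hz' := (mem_Z.1 hz).2
    refine mem_N.2 ⟨S.D z, mem_cast hz', u, mem_cast hu, ?_, h2.symm⟩
    rw [eq_sub_of_add_eq' h2.symm]
    exact sub_mem x.2.2 (mem_of_le hz')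

/-- The boundaries of the `r`-th page are the classes of the elements of `N_{r+1}`. -/
theorem mk_mem_range_dPage_iff {p' n' : ℤ} (hp : p' + r = p) (hn : n' + 1 = n)
    (x : S.Z r p n) : Submodule.Quotient.mk x ∈ LinearMap.range (S.dPage r hp hn) ↔
      (x : T) ∈ S.N (r + 1) p n := by
  constructor
  · rintro ⟨y, hy⟩
    obtain ⟨w, rfl⟩ := Submodule.Quotient.mk_surjective _ y
    rw [dPage_mk, eq_comm, ← sub_eq_zero, ← Submodule.Quotient.mk_sub,
      mk_eq_zero_iff] at hy
    have h2 : S.D w ∈ S.N (r + 1) p n :=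
      mem_N.2 ⟨0, zero_mem _, w, mem_cast w.2.1, mem_cast w.2.2, zero_add _⟩
    have := add_mem (N_le_succ r p n hy) h2
    simpa using this
  · intro h
    obtain ⟨u, hu, w, hw, hw', h⟩ := mem_N.1 h
    have hwZ : w ∈ S.Z r p' n' := mem_Z.2 ⟨mem_cast hw, mem_cast hw'⟩
    refine ⟨Submodule.Quotient.mk ⟨w, hwZ⟩, ?_⟩
    rw [dPage_mk, eq_comm, ← sub_eq_zero, ← Submodule.Quotient.mk_sub,
      mk_eq_zero_iff]
    refine Submodule.mem_sup_left ?_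
    simp [← h, hu]

/-- The subquotient of `E_r^{p,n-p}` given by cycles and boundaries of the `r`-th page is
`E_{r+1}^{p,n-p}`. -/
theorem nonempty_equiv_page_succ (A R : Submodule F (S.Page r p n))
    (hA : ∀ x : S.Z r p n, Submodule.Quotient.mk x ∈ A ↔
      ∃ z ∈ S.Z (r + 1) p n, (x : T) - z ∈ S.N r p n)
    (hR : ∀ x : S.Z r p n, Submodule.Quotient.mk x ∈ R ↔ (x : T) ∈ S.N (r + 1) p n) :
    Nonempty ((A ⧸ R.submoduleOf A) ≃ₗ[F] S.Page (r + 1) p n) := by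
  let i : S.Z (r + 1) p n →ₗ[F] A :=
    (Submodule.mkQ _ ∘ₗ Submodule.inclusion (Z_succ_le r p n)).codRestrict A fun z =>
      (hA _).2 ⟨z, z.2, by simp⟩
  refine nonempty_equiv_of_surjective (Submodule.mkQ _ ∘ₗ i) (Submodule.mkQ _) ?_
    (Submodule.mkQ_surjective _) fun z => ?_
  · intro y
    obtain ⟨⟨a, ha⟩, rfl⟩ := Submodule.mkQ_surjective _ y
    obtain ⟨x, rfl⟩ := Submodule.Quotient.mk_surjective _ a
    obtain ⟨z, hz, h⟩ := (hA x).1 ha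
    refine ⟨⟨z, hz⟩, ?_⟩
    refine congrArg (Submodule.mkQ _) (Subtype.ext (Eq.symm ?_))
    change Submodule.Quotient.mk x = Submodule.Quotient.mk _
    rw [← sub_eq_zero, ← Submodule.Quotient.mk_sub, mk_eq_zero_iff]
    exact h
  · rw [Submodule.mkQ_apply, mk_eq_zero_iff, LinearMap.comp_apply, Submodule.mkQ_apply,
      Submodule.Quotient.mk_eq_zero]
    exact hR _

theorem rel_degree {r : ℤ} {a b : ℕ × ℕ}
    (h : (ComplexShape.spectralSequenceNat ⟨r, 1 - r⟩).Rel a b) :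
    (a.1 + a.2 : ℤ) + 1 = b.1 + b.2 := by
  have h1 := h.1
  have h2 := h.2
  dsimp at h1 h2
  lia

variable (S) in
/-- The `r`-th page. -/
noncomputable def pageComplex (r : ℤ) (_hr : 2 ≤ r) :
    HomologicalComplex (ModuleCat.{uM} F) (ComplexShape.spectralSequenceNat ⟨r, 1 - r⟩) where
  X pq := ModuleCat.of F (S.Page r pq.1 (pq.1 + pq.2))
  d a b := open scoped Classical in
    if h : (ComplexShape.spectralSequenceNat ⟨r, 1 - r⟩).Rel a b then
      ModuleCat.ofHom (S.dPage r h.1 (rel_degree h))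
    else 0
  shape a b h := dif_neg h
  d_comp_d' a b c hab hbc := by
    rw [dif_pos hab, dif_pos hbc]
    ext x
    exact (mk_eq_zero_iff ⟨_, D_mem_Z hbc.1 (rel_degree hbc) (D_mem_Z hab.1 (rel_degree hab) x.2)⟩).2
      (by simp [S.D_D])

theorem pageComplex_d_of_rel (hr : 2 ≤ r) {a b : ℕ × ℕ}
    (h : (ComplexShape.spectralSequenceNat ⟨r, 1 - r⟩).Rel a b) :
    (S.pageComplex r hr).d a b = ModuleCat.ofHom (S.dPage r h.1 (rel_degree h)) :=
  dif_pos h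

/-- If the differential of the `r`-th page leads out of the first quadrant, everything is a cycle. -/
theorem exists_mem_Z_succ_of_lt (h : n + 1 < p + r) (x : S.Z r p n) :
    ∃ z ∈ S.Z (r + 1) p n, (x : T) - z ∈ S.N r p n := by
  have hx := (mem_Z.1 x.2).2
  rw [S.eq_bot h] at hx
  exact ⟨x, mem_Z.2 ⟨x.2.1, by rw [(Submodule.mem_bot F).1 hx]; exact zero_mem _⟩, by simp⟩

/-- If the differential of the `r`-th page comes from outside of the first quadrant, nothing more has
to be divided out. -/
theorem N_succ_eq_of_lt (h : p < r) : S.N (r + 1) p n = S.N r p n := by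
  rw [N, N, S.eq_of_nonpos (p := p - r + 1) _ (by lia),
    S.eq_of_nonpos (p := p - (r + 1) + 1) _ (by lia)]

theorem mk_mem_ker_pageComplex_d (hr : 2 ≤ r) (a : ℕ × ℕ) (x : S.Z r a.1 (a.1 + a.2)) :
    Submodule.Quotient.mk x ∈ LinearMap.ker ((S.pageComplex r hr).d a
        ((ComplexShape.spectralSequenceNat ⟨r, 1 - r⟩).next a)).hom ↔
      ∃ z ∈ S.Z (r + 1) a.1 (a.1 + a.2), (x : T) - z ∈ S.N r a.1 (a.1 + a.2) := by
  by_cases h : r ≤ a.2 + 1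
  · obtain ⟨r', rfl⟩ := Int.eq_ofNat_of_zero_le (show 0 ≤ r by lia)
    have hrel : (ComplexShape.spectralSequenceNat ⟨(r' : ℤ), 1 - r'⟩).Rel a
        (a.1 + r', a.2 + 1 - r') := ⟨by simp, by dsimp; lia⟩
    rw [(ComplexShape.spectralSequenceNat ⟨(r' : ℤ), 1 - r'⟩).next_eq' hrel,
      pageComplex_d_of_rel hr hrel]
    exact dPage_mk_eq_zero_iff hrel.1 (rel_degree hrel) x
  · have hrel (b) : ¬ (ComplexShape.spectralSequenceNat ⟨r, 1 - r⟩).Rel a b := fun hb => by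
      have := hb.2
      dsimp at this
      lia
    rw [(S.pageComplex r hr).shape _ _ (hrel _)]
    exact iff_of_true rfl (exists_mem_Z_succ_of_lt (by lia) x)

theorem mk_mem_range_pageComplex_d (hr : 2 ≤ r) (a : ℕ × ℕ) (x : S.Z r a.1 (a.1 + a.2)) :
    Submodule.Quotient.mk x ∈ LinearMap.range ((S.pageComplex r hr).d
        ((ComplexShape.spectralSequenceNat ⟨r, 1 - r⟩).prev a) a).hom ↔
      (x : T) ∈ S.N (r + 1) a.1 (a.1 + a.2) := by
  by_cases h : r ≤ a.1
  · obtain ⟨r', rfl⟩ := Int.eq_ofNat_of_zero_le (show 0 ≤ r by lia)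
    have hrel : (ComplexShape.spectralSequenceNat ⟨(r' : ℤ), 1 - r'⟩).Rel
        (a.1 - r', a.2 + r' - 1) a := ⟨by dsimp; lia, by dsimp; lia⟩
    rw [(ComplexShape.spectralSequenceNat ⟨(r' : ℤ), 1 - r'⟩).prev_eq' hrel,
      pageComplex_d_of_rel hr hrel]
    exact mk_mem_range_dPage_iff hrel.1 (rel_degree hrel) x
  · have hrel (b) : ¬ (ComplexShape.spectralSequenceNat ⟨r, 1 - r⟩).Rel b a := fun hb => by
      have := hb.1
      dsimp at this
      lia
    rw [(S.pageComplex r hr).shape _ _ (hrel _), N_succ_eq_of_lt (by lia), ← mk_eq_zero_iff,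
      ModuleCat.hom_zero, LinearMap.range_zero]
    exact Iff.rfl

theorem nonempty_homology_iso (hr : 2 ≤ r) (hr' : 2 ≤ r + 1) (a : ℕ × ℕ) :
    Nonempty ((S.pageComplex r hr).homology a ≅ (S.pageComplex (r + 1) hr').X a) := by
  obtain ⟨e⟩ := nonempty_equiv_page_succ _ _ (mk_mem_ker_pageComplex_d (S := S) hr a)
    (mk_mem_range_pageComplex_d hr a)
  refine ⟨((S.pageComplex r hr).sc a).moduleCatHomologyIso ≪≫ LinearEquiv.toModuleIso
    ((Submodule.quotEquivOfEq _ _ ?_).trans e)⟩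
  ext y
  exact exists_congr fun _ => Subtype.ext_iff

variable (S) in
/-- The spectral sequence of a filtered differential module. -/
noncomputable def spectralSequence : E₂CohomologicalSpectralSequenceNat (ModuleCat.{uM} F) where
  page r hr := S.pageComplex r hr
  iso r r' pq h hr := by
    subst h
    exact (nonempty_homology_iso hr (by lia) pq).some

/-! ### Convergence -/

section Convergence

variable {K : ℕ → Type uN} [∀ n, AddCommGroup (K n)] [∀ n, Module F (K n)]
  {d : ∀ n, K n →ₗ[F] K (n + 1)} (ε : ∀ n, K n →ₗ[F] T)

theorem mem_coboundaries_iff (hε : ∀ n, Function.Injective (ε n))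
    (hrange : ∀ n : ℕ, LinearMap.range (ε n) = S.G 0 n) (hD : ∀ n v, S.D (ε n v) = ε (n + 1) (d n v))
    (n : ℕ) (v : K n) : v ∈ coboundaries d n ↔ ∃ t ∈ S.G 0 (n - 1), ε n v = S.D t := by
  cases n with
  | zero =>
    rw [S.eq_bot (by simp)]
    simp only [coboundaries, Submodule.mem_bot, exists_eq_left, map_zero]
    exact (map_eq_zero_iff _ (hε 0)).symm
  | succ n =>
    have : ((n + 1 : ℕ) : ℤ) - 1 = n := by simp
    rw [this, ← hrange]
    constructor
    · rintro ⟨t, rfl⟩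
      exact ⟨_, ⟨t, rfl⟩, (hD n t).symm⟩
    · rintro ⟨_, ⟨t, rfl⟩, h⟩
      exact ⟨t, hε _ (by rw [h, hD])⟩

/-- If the parts of the various degrees of the filtered differential module `T` form the complex
`K`, then the spectral sequence converges to the cohomology of `K`, filtered by the classes of
cocycles of given filtration degree. -/
theorem convergesTo (hε : ∀ n, Function.Injective (ε n))
    (hrange : ∀ n : ℕ, LinearMap.range (ε n) = S.G 0 n)
    (hD : ∀ n v, S.D (ε n v) = ε (n + 1) (d n v)) :
    ConvergesTo S.spectralSequence (Cohomology d) := by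
  have hcob := mem_coboundaries_iff (S := S) ε hε hrange hD
  let C (n : ℕ) (p : ℤ) : Submodule F (LinearMap.ker (d n)) :=
    ((S.G p n).comap (ε n)).comap (LinearMap.ker (d n)).subtype
  have hC {n : ℕ} {p : ℤ} (v) : v ∈ C n p ↔ ε n v ∈ S.G p n := Iff.rfl
  have hdd (n : ℕ) (v : LinearMap.ker (d n)) : S.D (ε n v) = 0 := by
    rw [hD, v.2, map_zero]
  refine ⟨fun n p => (C n p).map (Submodule.mkQ _), fun n p p' h => Submodule.map_mono
    fun v hv => mem_of_le hv, fun n => ?_, fun n => ?_, fun p q r hr hp hq => ?_⟩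
  · have : C n (0 : ℕ) = ⊤ := by
      ext v
      simp [hC, ← hrange]
    change (C n (0 : ℕ)).map _ = ⊤
    rw [this, Submodule.map_top, Submodule.range_mkQ]
  · have : C n (n + 1 : ℕ) = ⊥ := by
      ext v
      rw [hC, S.eq_bot (by simp), Submodule.mem_bot, map_eq_zero_iff _ (hε n)]
      simp
    change (C n (n + 1 : ℕ)).map _ = ⊥
    rw [this, Submodule.map_bot]
  · have hv (v : C (p + q) p) : ε (p + q) v.1 ∈ S.G p ((p + q : ℕ) : ℤ) := v.2
    have hZ (v : C (p + q) p) : ε (p + q) v.1 ∈ S.Z r p (p + q) :=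
      mem_Z.2 ⟨mem_cast (hv v), by rw [hdd]; exact zero_mem _⟩
    let f : C (p + q) p →ₗ[F] S.Page r p (p + q) := Submodule.mkQ _ ∘ₗ
      (ε _ ∘ₗ (Submodule.subtype _) ∘ₗ (Submodule.subtype _)).codRestrict (S.Z r p (p + q)) hZ
    let W := (C (p + q) p).map (Submodule.mkQ ((coboundaries d (p + q)).submoduleOf _))
    let W' := (C (p + q) (p + 1 : ℕ)).map
      (Submodule.mkQ ((coboundaries d (p + q)).submoduleOf _))
    let g : C (p + q) p →ₗ[F] W ⧸ W'.submoduleOf W := Submodule.mkQ _ ∘ₗ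
      (Submodule.mkQ _ ∘ₗ Submodule.subtype _).codRestrict W fun v => ⟨v, v.2, rfl⟩
    refine nonempty_equiv_of_surjective f g ?_ ?_ fun v => ?_
    · intro y
      obtain ⟨⟨x, hx⟩, rfl⟩ := Submodule.mkQ_surjective _ y
      have hx0 : x ∈ S.G 0 ((p + q : ℕ) : ℤ) := mem_of_le hx.1
      rw [← hrange] at hx0
      obtain ⟨v, rfl⟩ := hx0
      have hv := (mem_Z.1 hx).2
      rw [S.eq_bot (by lia), Submodule.mem_bot, hD, map_eq_zero_iff _ (hε _)] at hv
      exact ⟨⟨⟨v, hv⟩, mem_cast hx.1⟩, rfl⟩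
    · intro y
      obtain ⟨⟨_, ⟨x, hx, rfl⟩⟩, rfl⟩ := Submodule.mkQ_surjective _ y
      exact ⟨⟨x, hx⟩, rfl⟩
    · have h1 : f v = 0 ↔ ε (p + q) v.1 ∈ S.N r p (p + q) := mk_eq_zero_iff ⟨_, hZ v⟩
      have h2 : g v = 0 ↔ Submodule.mkQ _ v.1 ∈ W' := by
        rw [LinearMap.comp_apply, Submodule.mkQ_apply, Submodule.Quotient.mk_eq_zero]
        rfl
      refine h1.trans (Iff.trans ?_ h2.symm)
      rw [mem_N]
      constructor
      · rintro ⟨u, hu, t, ht, ht', h⟩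
        have hu0 : u ∈ S.G 0 ((p + q : ℕ) : ℤ) := mem_of_le hu
        rw [← hrange] at hu0
        obtain ⟨w, rfl⟩ := hu0
        have hw : w ∈ LinearMap.ker (d (p + q)) := by
          have := congrArg S.D h
          rw [map_add, S.D_D, add_zero, hdd, hD, map_eq_zero_iff _ (hε _)] at this
          exact this
        refine ⟨⟨w, hw⟩, mem_cast hu, ?_⟩
        rw [eq_comm, ← sub_eq_zero, ← map_sub, Submodule.mkQ_apply, Submodule.Quotient.mk_eq_zero]
        refine (hcob _ _).2 ⟨t, ?_, ?_⟩
        · rw [S.eq_of_nonpos _ (by lia)] at ht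
          exact mem_cast ht
        · rw [Submodule.subtype_apply, Submodule.coe_sub, map_sub, ← h, add_sub_cancel_left]
      · rintro ⟨w, hw, h⟩
        rw [eq_comm, ← sub_eq_zero, ← map_sub, Submodule.mkQ_apply,
          Submodule.Quotient.mk_eq_zero] at h
        obtain ⟨t, ht, h⟩ := (hcob _ _).1 h
        rw [Submodule.subtype_apply, Submodule.coe_sub, map_sub] at h
        have hw : ε (p + q) w ∈ S.G (p + 1 : ℕ) ((p + q : ℕ) : ℤ) := hw
        refine ⟨ε (p + q) w, mem_cast hw, t, ?_, ?_, ?_⟩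
        · rw [S.eq_of_nonpos _ (by lia)]
          exact mem_cast ht
        · rw [← h]
          exact sub_mem (mem_cast (hv v)) (mem_of_le hw)
        · rw [← h, add_sub_cancel]

end Convergence

/-! ### The second page -/

/-- If the first page, with its differential, is a family of complexes `(X, δ)` via
`σ : Z_1 → X`, then the second page is their cohomology. -/
theorem nonempty_page_two_equiv {X : ℕ → Type uN} [∀ p, AddCommGroup (X p)]
    [∀ p, Module F (X p)] (δ : ∀ p, X p →ₗ[F] X (p + 1)) (q : ℤ) (σ : ∀ p, T →ₗ[F] X p)
    (hker : ∀ (p : ℕ), ∀ x ∈ S.Z 1 p (p + q), σ p x = 0 ↔ x ∈ S.N 1 p (p + q))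
    (hsurj : ∀ (p : ℕ) (ξ : X p), ∃ x ∈ S.Z 1 p (p + q), σ p x = ξ)
    (hσ : ∀ (p : ℕ), ∀ x ∈ S.Z 1 p (p + q), σ (p + 1) (S.D x) = δ p (σ p x)) (p : ℕ) :
    Nonempty (S.Page 2 p (p + q) ≃ₗ[F] Cohomology δ p) := by
  have hZ {p : ℕ} {x} (hx : x ∈ S.Z 2 p (p + q)) : x ∈ S.Z 1 p (p + q) := Z_succ_le 1 _ _ hx
  have hD {p : ℕ} {x} (hx : x ∈ S.Z 1 p (p + q)) : S.D x ∈ S.Z 1 (p + 1 : ℕ) ((p + 1 : ℕ) + q) :=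
    D_mem_Z (by simp) (by push_cast; ring) hx
  have hδ (x : S.Z 2 p (p + q)) : σ p x ∈ LinearMap.ker (δ p) := by
    rw [LinearMap.mem_ker, ← hσ p x (hZ x.2), hker _ _ (hD (hZ x.2))]
    exact Submodule.mem_sup_left (mem_cast (mem_Z.1 x.2).2)
  have hG {p : ℕ} {w} (hw : w ∈ S.G (p + 1) (p + q)) : w ∈ S.Z 1 p (p + q) ∧ σ p w = 0 := by
    have : w ∈ S.Z 1 p (p + q) := mem_Z.2 ⟨mem_of_le hw, S.D_mem hw⟩
    exact ⟨this, (hker p w this).2 (Submodule.mem_sup_left hw)⟩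
  refine nonempty_equiv_of_surjective (Submodule.mkQ _)
    (Submodule.mkQ _ ∘ₗ (σ p ∘ₗ Submodule.subtype _).codRestrict _ hδ)
    (Submodule.mkQ_surjective _) ?_ fun x => ?_
  · intro y
    obtain ⟨⟨ξ, hξ⟩, rfl⟩ := Submodule.mkQ_surjective _ y
    obtain ⟨x, hx, rfl⟩ := hsurj p ξ
    rw [LinearMap.mem_ker, ← hσ p x hx, hker _ _ (hD hx), mem_N] at hξ
    obtain ⟨u, hu, w, hw, hw', h⟩ := hξ
    have hw1 : w ∈ S.G (p + 1) (p + q) := mem_cast hw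
    refine ⟨⟨x - w, mem_Z.2 ⟨sub_mem hx.1 (mem_of_le hw1), ?_⟩⟩, ?_⟩
    · rw [map_sub, ← h, add_sub_cancel_right]
      exact mem_cast hu
    · refine congrArg (Submodule.mkQ _) (Subtype.ext ?_)
      change σ p (x - w) = σ p x
      rw [map_sub, (hG hw1).2, sub_zero]
  · rw [Submodule.mkQ_apply, mk_eq_zero_iff, LinearMap.comp_apply, Submodule.mkQ_apply,
      Submodule.Quotient.mk_eq_zero]
    obtain ⟨x, hx⟩ := x
    change x ∈ S.N (1 + 1) p (p + q) ↔ σ p x ∈ coboundaries δ p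
    cases p with
    | zero =>
      rw [N_succ_eq_of_lt (by simp), ← hker 0 x (hZ hx)]
      exact (Submodule.mem_bot F).symm
    | succ p =>
      constructor
      · intro h
        obtain ⟨u, hu, w, hw, hw', h⟩ := mem_N.1 h
        have hwZ : w ∈ S.Z 1 p (p + q) := mem_Z.2 ⟨mem_cast hw, mem_cast hw'⟩
        refine ⟨σ p w, ?_⟩
        rw [← hσ p w hwZ]
        rw [← h, map_add, (hG hu).2, zero_add]
      · rintro ⟨η, h⟩
        obtain ⟨w, hw, rfl⟩ := hsurj p η
        rw [← hσ p w hw, eq_comm, ← sub_eq_zero] at h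
        rw [← map_sub, hker _ _ (sub_mem (hZ hx) (hD hw))] at h
        have h2 : S.D w ∈ S.N 2 (p + 1 : ℕ) ((p + 1 : ℕ) + q) :=
          mem_N.2 ⟨0, zero_mem _, w, mem_cast hw.1, mem_cast (mem_Z.1 hw).2, zero_add _⟩
        have := add_mem (N_le_succ _ _ _ h) h2
        simpa using this

end FilteredDifferential
/-! ### Cochains of all degrees -/

section Total

variable {F : Type uF} [Field F]
variable {L : Type uL} [NonUnitalNonAssocRing L] [Module F L]
variable {M : Type uM} [AddCommGroup M] [Module F M]

variable (F L M) in
/-- Families of cochains, one of each degree. Working in this space avoids transports between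
cochain spaces of propositionally equal degrees. -/
abbrev Tot : Type (max uL uM) := ∀ n, CL F L M n

/-- The insertion `(i_x f)(x_1, …, x_n) = f(x, x_1, …, x_n)`. -/
def ins : L →ₗ[F] Tot F L M →ₗ[F] Tot F L M :=
  LinearMap.mk₂ F (fun x f n => (f (n + 1)).curryLeft x)
    (by intros; funext n; simp) (by intros; funext n; simp)
    (by intros; rfl) (by intros; rfl)

theorem ins_apply (x : L) (f : Tot F L M) (n : ℕ) : ins x f n = (f (n + 1)).curryLeft x := rfl

/-- The family of cochains without term of degree `0` with prescribed insertions. -/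
def glue : (L →ₗ[F] Tot F L M) →ₗ[F] Tot F L M where
  toFun φ
    | 0 => 0
    | n + 1 => LinearMap.uncurryLeft (LinearMap.proj n ∘ₗ φ)
  map_add' φ ψ := by
    funext n
    cases n with
    | zero => simp
    | succ n => ext; simp
  map_smul' c φ := by
    funext n
    cases n with
    | zero => simp
    | succ n => ext; simp

@[simp] theorem ins_glue (x : L) (φ : L →ₗ[F] Tot F L M) : ins x (glue φ) = φ x := by
  funext n
  ext v
  simp [ins_apply, glue]

variable (F L M) in
/-- The families concentrated in degree `n`. For `n < 0` only the zero family is so. -/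
def homog (n : ℤ) : Submodule F (Tot F L M) where
  carrier := {f | ∀ m : ℕ, (m : ℤ) ≠ n → f m = 0}
  add_mem' hf hg m hm := by simp [hf m hm, hg m hm]
  zero_mem' m _ := rfl
  smul_mem' c f hf m hm := by simp [hf m hm]

theorem ins_mem_homog {n : ℤ} {f : Tot F L M} (hf : f ∈ homog F L M (n + 1)) (x : L) :
    ins x f ∈ homog F L M n := fun m hm => by
  rw [ins_apply, hf (m + 1) (by push_cast; lia)]
  rfl

theorem glue_mem_homog {n : ℤ} {φ : L →ₗ[F] Tot F L M} (hφ : ∀ x, φ x ∈ homog F L M n) :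
    glue φ ∈ homog F L M (n + 1) := fun m hm => by
  cases m with
  | zero => rfl
  | succ m =>
    ext v
    simp [glue, hφ (v 0) m (by push_cast at hm; lia)]

variable (F L M) in
/-- A cochain of degree `n`, seen as a family. -/
def inDegree (n : ℕ) : CL F L M n →ₗ[F] Tot F L M := LinearMap.single F _ n

@[simp] theorem inDegree_same {n : ℕ} (f : CL F L M n) : inDegree F L M n f n = f := by
  simp [inDegree]

theorem inDegree_of_ne {n m : ℕ} (h : m ≠ n) (f : CL F L M n) : inDegree F L M n f m = 0 := by
  simp [inDegree, h]

theorem inDegree_mem_homog {n : ℕ} (f : CL F L M n) : inDegree F L M n f ∈ homog F L M n :=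
  fun _ hm => inDegree_of_ne (by simpa using hm) f

theorem inDegree_of_mem_homog {n : ℕ} {f : Tot F L M} (hf : f ∈ homog F L M n) :
    inDegree F L M n (f n) = f := by
  funext m
  rcases eq_or_ne m n with rfl | h
  · simp
  · rw [inDegree_of_ne h, hf m (by simpa using h)]

theorem ins_inDegree_succ {n : ℕ} (f : CL F L M (n + 1)) (x : L) :
    ins x (inDegree F L M (n + 1) f) = inDegree F L M n (f.curryLeft x) := by
  funext m
  rw [ins_apply]
  rcases eq_or_ne m n with rfl | h
  · simp
  · rw [inDegree_of_ne h, inDegree_of_ne (by simpa using h)]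
    rfl

theorem ins_inDegree_zero (f : CL F L M 0) (x : L) : ins x (inDegree F L M 0 f) = 0 := by
  funext m
  rw [ins_apply, inDegree_of_ne (by simp)]
  rfl

variable [IsScalarTower F L L] [SMulCommClass F L L]

/-- The Lie derivative on families of cochains. -/
def lieTot (A : LeftModule F L M) : L →ₗ[F] Tot F L M →ₗ[F] Tot F L M :=
  LinearMap.mk₂ F (fun x f n => lieDer A n x (f n))
    (by intros; funext n; simp) (by intros; funext n; simp)
    (by intros; funext n; simp) (by intros; funext n; simp)

theorem lieTot_apply (A : LeftModule F L M) (x : L) (f : Tot F L M) (n : ℕ) :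
    lieTot A x f n = lieDer A n x (f n) := rfl

theorem ins_lieTot (A : LeftModule F L M) (x y : L) (f : Tot F L M) :
    ins y (lieTot A x f) = lieTot A x (ins y f) - ins (x * y) f := by
  funext n
  exact curryLeft_lieDer A x y _

/-- The Leibniz coboundary on families of cochains. -/
noncomputable def dTot (B : Bimodule F L M) : Tot F L M →ₗ[F] Tot F L M where
  toFun f
    | 0 => 0
    | n + 1 => coboundary B n (f n)
  map_add' f g := by
    funext n
    cases n <;> simp
  map_smul' c f := by
    funext n
    cases n <;> simp

theorem dTot_zero (B : Bimodule F L M) (f : Tot F L M) : dTot B f 0 = 0 := rfl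

theorem dTot_succ (B : Bimodule F L M) (f : Tot F L M) (n : ℕ) :
    dTot B f (n + 1) = coboundary B n (f n) := rfl

theorem dTot_mem_coboundaries (B : Bimodule F L M) (f : Tot F L M) (n : ℕ) :
    dTot B f n ∈ coboundaries (coboundary B) n := by
  cases n with
  | zero => exact zero_mem _
  | succ n => exact ⟨_, rfl⟩

theorem dTot_mem_homog (B : Bimodule F L M) {n : ℤ} {f : Tot F L M} (hf : f ∈ homog F L M n) :
    dTot B f ∈ homog F L M (n + 1) := fun m hm => by
  cases m with
  | zero => rfl
  | succ m => rw [dTot_succ, hf m (by push_cast at hm; lia), map_zero]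

theorem dTot_inDegree (B : Bimodule F L M) {n : ℕ} (f : CL F L M n) :
    dTot B (inDegree F L M n f) = inDegree F L M (n + 1) (coboundary B n f) := by
  funext m
  cases m with
  | zero => rw [dTot_zero, inDegree_of_ne (by simp)]
  | succ m =>
    rw [dTot_succ]
    rcases eq_or_ne m n with rfl | h
    · simp
    · rw [inDegree_of_ne h, inDegree_of_ne (by simpa using h), map_zero]

theorem dTot_dTot [IsLeftLeibniz L] (B : Bimodule F L M) (f : Tot F L M) :
    dTot B (dTot B f) = 0 := by
  funext n
  cases n with
  | zero => rfl
  | succ n =>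
    rw [dTot_succ]
    cases n with
    | zero => rw [dTot_zero, map_zero]; rfl
    | succ n => exact coboundary_coboundary B n (f n)

/-- The amount by which Cartan's formula fails, which is concentrated in degree `0`. -/
noncomputable def cartanDefect (B : Bimodule F L M) (x : L) (f : Tot F L M) : Tot F L M :=
  ins x (dTot B f) - (lieTot B.toLeftModule x f - dTot B (ins x f))

theorem ins_dTot (B : Bimodule F L M) (x : L) (f : Tot F L M) :
    ins x (dTot B f) = lieTot B.toLeftModule x f - dTot B (ins x f) + cartanDefect B x f := by
  simp [cartanDefect]

theorem cartanDefect_succ (B : Bimodule F L M) (x : L) (f : Tot F L M) (n : ℕ) :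
    cartanDefect B x f (n + 1) = 0 := by
  have := curryLeft_coboundary B (f (n + 1)) x
  simp only [cartanDefect, Pi.sub_apply, ins_apply, dTot_succ, lieTot_apply, this, sub_self]

/-! ### The filtration of the cochains defined by a left central ideal -/

variable (M) in
/-- The `p`-th step of the filtration: the families of cochains which vanish as soon as one of the
first `p` arguments lies in `J`. -/
def filt (J : Submodule F L) : ℕ → Submodule F (Tot F L M)
  | 0 => ⊤
  | p + 1 => (⨅ y : J, LinearMap.ker (ins (y : L))) ⊓ ⨅ x : L, (filt J p).comap (ins x)

variable {J : Submodule F L}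

theorem mem_filt_succ {p : ℕ} {f : Tot F L M} :
    f ∈ filt M J (p + 1) ↔ (∀ y ∈ J, ins y f = 0) ∧ ∀ x, ins x f ∈ filt M J p := by
  simp [filt]

theorem mem_filt_zero (f : Tot F L M) : f ∈ filt M J 0 := Submodule.mem_top

theorem filt_antitone : Antitone (filt M J) := by
  refine antitone_nat_of_succ_le fun p => ?_
  induction p with
  | zero => exact le_top
  | succ p ih =>
    intro f hf
    exact mem_filt_succ.2 ⟨(mem_filt_succ.1 hf).1, fun x => ih ((mem_filt_succ.1 hf).2 x)⟩

/-- A cochain of degree at most `p` lying in the `p`-th step lies in all of them: all of its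
arguments have been taken into account. -/
theorem mem_filt_of_forall_lt {p : ℕ} {f : Tot F L M} (hf : f ∈ filt M J p)
    (h : ∀ m, p < m → f m = 0) (p' : ℕ) : f ∈ filt M J p' := by
  induction p' generalizing p f with
  | zero => exact mem_filt_zero f
  | succ p' ih =>
    cases p with
    | zero =>
      have h0 (x : L) : ins x f = 0 := by
        funext n
        rw [ins_apply, h _ n.succ_pos]
        rfl
      exact mem_filt_succ.2 ⟨fun y _ => h0 y, fun x => (h0 x).symm ▸ zero_mem _⟩
    | succ p =>
      refine mem_filt_succ.2 ⟨(mem_filt_succ.1 hf).1,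
        fun x => ih ((mem_filt_succ.1 hf).2 x) fun m hm => ?_⟩
      rw [ins_apply, h _ (by lia)]
      rfl

theorem cartanDefect_mem (B : Bimodule F L M) (x : L) (f : Tot F L M) (p : ℕ) :
    cartanDefect B x f ∈ filt M J p :=
  mem_filt_of_forall_lt (mem_filt_zero _) (fun m hm => by
    obtain ⟨m, rfl⟩ := Nat.exists_eq_succ_of_ne_zero hm.ne'
    exact cartanDefect_succ B x f m) p

variable (J) in
/-- `J` is a left central ideal which acts trivially on the bimodule. -/
structure IsNegligible (B : Bimodule F L M) : Prop where
  mul_eq_zero {y : L} (hy : y ∈ J) (x : L) : y * x = 0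
  mul_mem (x : L) {y : L} (hy : y ∈ J) : x * y ∈ J
  left_eq_zero {y : L} (hy : y ∈ J) : B.left y = 0
  right_eq_zero {y : L} (hy : y ∈ J) : B.right y = 0

variable {B : Bimodule F L M}

theorem lieTot_mem (h : IsNegligible J B) (x : L) {p : ℕ} {f : Tot F L M} (hf : f ∈ filt M J p) :
    lieTot B.toLeftModule x f ∈ filt M J p := by
  induction p generalizing f with
  | zero => exact mem_filt_zero _
  | succ p ih =>
    rw [mem_filt_succ] at hf
    refine mem_filt_succ.2 ⟨fun y hy => ?_, fun y => ?_⟩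
    · rw [ins_lieTot, hf.1 y hy, hf.1 _ (h.mul_mem x hy), map_zero, sub_zero]
    · rw [ins_lieTot]
      exact sub_mem (ih (hf.2 y)) (hf.2 _)

/-- For arguments in `J` the Lie derivative vanishes, and Cartan's formula holds in degree `0`, too. -/
theorem ins_dTot_of_mem (h : IsNegligible J B) {y : L} (hy : y ∈ J) (f : Tot F L M) :
    ins y (dTot B f) = -dTot B (ins y f) := by
  have hθ (n : ℕ) (g : CL F L M n) : lieDer B.toLeftModule n y g = 0 := by
    ext v
    rw [lieDer_apply, h.left_eq_zero hy]
    simp [h.mul_eq_zero hy]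
  funext n
  cases n with
  | zero =>
    ext v
    rw [ins_apply, dTot_succ, curryLeft_coboundary_zero, h.right_eq_zero hy]
    simp [dTot_zero]
  | succ n =>
    rw [ins_apply, dTot_succ, curryLeft_coboundary, hθ, zero_sub]
    rfl

theorem dTot_mem (h : IsNegligible J B) {p : ℕ} {f : Tot F L M} (hf : f ∈ filt M J p) :
    dTot B f ∈ filt M J p := by
  induction p generalizing f with
  | zero => exact mem_filt_zero _
  | succ p ih =>
    have hf' := mem_filt_succ.1 hf
    refine mem_filt_succ.2 ⟨fun y hy => ?_, fun x => ?_⟩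
    · rw [ins_dTot_of_mem h hy, hf'.1 y hy, map_zero, neg_zero]
    · rw [ins_dTot]
      exact add_mem (sub_mem (lieTot_mem h x (filt_antitone p.le_succ hf)) (ih (hf'.2 x)))
        (cartanDefect_mem B x f p)

variable (M J) in
/-- The families of cochains which vanish as soon as one of the arguments lies in `J`. -/
def negligible : Submodule F (Tot F L M) := ⨅ p, filt M J p

theorem mem_negligible {f : Tot F L M} : f ∈ negligible M J ↔ ∀ p, f ∈ filt M J p := by
  simp [negligible]

/-- The cochains modulo the negligible ones, filtered by `filt`. Degrees are shifted by one, as in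
the relative complex. -/
noncomputable def relFiltered [IsLeftLeibniz L] (h : IsNegligible J B) :
    FilteredDifferential F (Tot F L M ⧸ negligible M J) where
  D := Submodule.mapQ _ _ (dTot B) fun f hf =>
    mem_negligible.2 fun p => dTot_mem h (mem_negligible.1 hf p)
  D_D x := by
    obtain ⟨f, rfl⟩ := Submodule.mkQ_surjective _ x
    simp [dTot_dTot]
  G p n := (filt M J p.toNat ⊓ homog F L M (n + 1)).map (Submodule.mkQ _)
  anti n hp := Submodule.map_mono (inf_le_inf_right _ (filt_antitone (Int.toNat_le_toNat hp)))
  D_mem := by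
    rintro p n _ ⟨f, hf, rfl⟩
    exact ⟨dTot B f, ⟨dTot_mem h hf.1, dTot_mem_homog B hf.2⟩, rfl⟩
  eq_of_nonpos n hp := by rw [Int.toNat_of_nonpos hp, Int.toNat_zero]
  eq_bot {p n} hnp := by
    rw [eq_bot_iff]
    rintro _ ⟨f, hf, rfl⟩
    refine (Submodule.Quotient.mk_eq_zero _).2 (mem_negligible.2 ?_)
    exact mem_filt_of_forall_lt hf.1 fun m hm => hf.2 m (by lia)

end Total
/-! ### The symbol of a cochain -/

section Symbol

variable {F : Type uF} [Field F]
variable {I : Type uI} [AddCommGroup I] [Module F I]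
variable {L : Type uL} [NonUnitalNonAssocRing L] [Module F L]
  [IsScalarTower F L L] [SMulCommClass F L L]
variable {Q : Type uQ} [NonUnitalNonAssocRing Q] [Module F Q]
  [IsScalarTower F Q Q] [SMulCommClass F Q Q]
variable {M : Type uM} [AddCommGroup M] [Module F M]
variable {N : Type uN} [AddCommGroup N] [Module F N]

/-- An extension of Leibniz algebras with left central kernel, together with linear splittings
`s : Q → L` of `π` and `τ : L → I` of `ι`. The kernel `I` only enters with its left
`Q`-module structure `A`. -/
structure SplitExtension (ι : I →ₗ[F] L) (π : L →ₙₐ[F] Q) (A : LeftModule F Q I)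
    (s : Q →ₗ[F] L) (τ : L →ₗ[F] I) : Prop where
  π_s (a : Q) : π (s a) = a
  τ_ι (y : I) : τ (ι y) = y
  π_eq_zero_iff (x : L) : π x = 0 ↔ x ∈ LinearMap.range ι
  ι_mul (y : I) (x : L) : ι y * x = 0
  ι_left (x : L) (y : I) : ι (A.left (π x) y) = x * ι y

/-- A space `N` describing the cohomology of the sequence `d` in degree `q`: the map `κ` sends
cocycles to their classes, `μ` chooses representatives, and `η` chooses primitives of
coboundaries. -/
structure CohomologyModel (B : Bimodule F L M) (q : ℕ) (κ : CL F L M q →ₗ[F] N)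
    (μ : N →ₗ[F] CL F L M q) (η : CL F L M q →ₗ[F] Tot F L M) : Prop where
  κ_coboundary {c : CL F L M q} (hc : c ∈ coboundaries (coboundary B) q) : κ c = 0
  coboundary_μ (z : N) : coboundary B q (μ z) = 0
  κ_μ (z : N) : κ (μ z) = z
  η_mem (c : CL F L M q) : η c ∈ homog F L M ((q : ℤ) - 1)
  dTot_η {c : CL F L M q} (hc : coboundary B q c = 0) (hc' : κ c = 0) :
    dTot B (η c) = inDegree F L M q c

/-- The symbol of a cochain `f` of degree `q + 1 + p`: the multilinear map which sends
`a_1, …, a_p` to `y ↦ κ (f(s a_1, …, s a_p, ι y, -))`. -/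
noncomputable def symbol (ι : I →ₗ[F] L) (s : Q →ₗ[F] L) (q : ℕ) (κ : CL F L M q →ₗ[F] N) :
    ∀ p, Tot F L M →ₗ[F] CL F Q (I →ₗ[F] N) p
  | 0 =>
    { toFun := fun f => MultilinearMap.constOfIsEmpty F _
        (κ ∘ₗ LinearMap.proj q ∘ₗ ins.flip f ∘ₗ ι)
      map_add' := by intros; ext; simp
      map_smul' := by intros; ext; simp }
  | p + 1 =>
    { toFun := fun f => LinearMap.uncurryLeft (symbol ι s q κ p ∘ₗ ins.flip f ∘ₗ s)
      map_add' := by intros; ext; simp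
      map_smul' := by intros; ext; simp }

/-- A cochain with prescribed symbol. -/
noncomputable def ofSymbol (π : L →ₙₐ[F] Q) (τ : L →ₗ[F] I) (q : ℕ) (μ : N →ₗ[F] CL F L M q) :
    ∀ p, CL F Q (I →ₗ[F] N) p →ₗ[F] Tot F L M
  | 0 =>
    { toFun := fun ξ => glue (inDegree F L M q ∘ₗ μ ∘ₗ ξ 0 ∘ₗ τ)
      map_add' := by intros; rw [← map_add]; congr 1; ext; simp
      map_smul' := by intros; rw [RingHom.id_apply, ← map_smul]; congr 1; ext; simp }
  | p + 1 =>
    { toFun := fun ξ => glue (ofSymbol π τ q μ p ∘ₗ ξ.curryLeft ∘ₗ (π : L →ₗ[F] Q))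
      map_add' := by
        intro ξ ξ'
        rw [← map_add]
        exact congrArg glue (LinearMap.ext fun x =>
          map_add (ofSymbol π τ q μ p) (ξ.curryLeft (π x)) (ξ'.curryLeft (π x)))
      map_smul' := by
        intro c ξ
        rw [RingHom.id_apply, ← map_smul]
        exact congrArg glue (LinearMap.ext fun x =>
          map_smul (ofSymbol π τ q μ p) c (ξ.curryLeft (π x))) }

/-- A cochain whose coboundary agrees modulo the next step of the filtration with a given cochain
of symbol zero. -/
noncomputable def primitive (ι : I →ₗ[F] L) (π : L →ₙₐ[F] Q) (s : Q →ₗ[F] L) (τ : L →ₗ[F] I)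
    (q : ℕ) (η : CL F L M q →ₗ[F] Tot F L M) : ℕ → (Tot F L M →ₗ[F] Tot F L M)
  | 0 =>
    { toFun := fun f => glue (-(η ∘ₗ LinearMap.proj q ∘ₗ ins.flip f ∘ₗ ι ∘ₗ τ))
      map_add' := by intros; rw [← map_add]; congr 1; ext; simp; abel
      map_smul' := by intros; rw [RingHom.id_apply, ← map_smul]; congr 1; ext; simp }
  | p + 1 =>
    { toFun := fun f =>
        glue (-(primitive ι π s τ q η p ∘ₗ ins.flip f ∘ₗ s ∘ₗ (π : L →ₗ[F] Q)))
      map_add' := by intros; rw [← map_add]; congr 1; ext; simp; abel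
      map_smul' := by intros; rw [RingHom.id_apply, ← map_smul]; congr 1; ext; simp }

variable {ι : I →ₗ[F] L} {π : L →ₙₐ[F] Q} {A : LeftModule F Q I}
  {s : Q →ₗ[F] L} {τ : L →ₗ[F] I} {B : Bimodule F Q M} {q : ℕ}
  {κ : CL F L M q →ₗ[F] N} {μ : N →ₗ[F] CL F L M q} {η : CL F L M q →ₗ[F] Tot F L M}

theorem symbol_zero_apply (f : Tot F L M) (v : Fin 0 → Q) (y : I) :
    symbol ι s q κ 0 f v y = κ (ins (ι y) f q) := rfl

theorem curryLeft_symbol_succ (p : ℕ) (f : Tot F L M) (a : Q) :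
    (symbol ι s q κ (p + 1) f).curryLeft a = symbol ι s q κ p (ins (s a) f) := rfl

theorem ins_ofSymbol_zero (ξ : CL F Q (I →ₗ[F] N) 0) (x : L) :
    ins x (ofSymbol (M := M) π τ q μ 0 ξ) = inDegree F L M q (μ (ξ 0 (τ x))) := by
  simp [ofSymbol]

theorem ins_ofSymbol_succ (p : ℕ) (ξ : CL F Q (I →ₗ[F] N) (p + 1)) (x : L) :
    ins x (ofSymbol (M := M) π τ q μ (p + 1) ξ) = ofSymbol π τ q μ p (ξ.curryLeft (π x)) := by
  simp [ofSymbol]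

theorem ins_primitive_zero (f : Tot F L M) (x : L) :
    ins x (primitive ι π s τ q η 0 f) = -η (ins (ι (τ x)) f q) := by
  simp [primitive]

theorem ins_primitive_succ (p : ℕ) (f : Tot F L M) (x : L) :
    ins x (primitive ι π s τ q η (p + 1) f) =
      -primitive ι π s τ q η p (ins (s (π x)) f) := by
  simp [primitive]

local notation "J" => LinearMap.range ι

theorem symbol_eq_zero (p : ℕ) {f : Tot F L M} (hf : f ∈ filt M J (p + 1)) :
    symbol ι s q κ p f = 0 := by
  induction p generalizing f with
  | zero =>
    ext v y
    rw [symbol_zero_apply, (mem_filt_succ.1 hf).1 _ ⟨y, rfl⟩]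
    simp
  | succ p ih =>
    refine curryLeft_injective fun a => ?_
    rw [curryLeft_symbol_succ, ih ((mem_filt_succ.1 hf).2 _)]
    rfl

theorem primitive_mem_homog (hN : CohomologyModel (B.comap π) q κ μ η) (p : ℕ) (f : Tot F L M) :
    primitive ι π s τ q η p f ∈ homog F L M (q + p) := by
  induction p generalizing f with
  | zero =>
    have := glue_mem_homog (φ := -(η ∘ₗ LinearMap.proj q ∘ₗ ins.flip f ∘ₗ ι ∘ₗ τ))
      fun x => neg_mem (hN.η_mem _)
    rw [sub_add_cancel] at this
    rw [Nat.cast_zero, add_zero]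
    exact this
  | succ p ih =>
    have := glue_mem_homog
      (φ := -(primitive ι π s τ q η p ∘ₗ ins.flip f ∘ₗ s ∘ₗ (π : L →ₗ[F] Q)))
      fun x => neg_mem (ih _)
    rw [add_assoc] at this
    exact_mod_cast this

theorem ofSymbol_mem_homog (p : ℕ) (ξ : CL F Q (I →ₗ[F] N) p) :
    ofSymbol (M := M) π τ q μ p ξ ∈ homog F L M (q + p + 1) := by
  induction p with
  | zero =>
    have := glue_mem_homog (φ := inDegree F L M q ∘ₗ μ ∘ₗ ξ 0 ∘ₗ τ)
      fun x => inDegree_mem_homog _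
    rw [Nat.cast_zero, add_zero]
    exact this
  | succ p ih =>
    have := glue_mem_homog (φ := ofSymbol (M := M) π τ q μ p ∘ₗ ξ.curryLeft ∘ₗ (π : L →ₗ[F] Q))
      fun x => ih _
    rw [add_assoc (q : ℤ)] at this
    exact_mod_cast this

variable (h : SplitExtension ι π A s τ)
include h

theorem SplitExtension.isNegligible : IsNegligible J (B.comap π) where
  mul_eq_zero := by
    rintro _ ⟨y, rfl⟩ x
    exact h.ι_mul y x
  mul_mem := by
    rintro x _ ⟨y, rfl⟩
    exact ⟨_, h.ι_left x y⟩
  left_eq_zero hy := by rw [Bimodule.comap_left, (h.π_eq_zero_iff _).2 hy, map_zero]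
  right_eq_zero hy := by rw [Bimodule.comap_right, (h.π_eq_zero_iff _).2 hy, map_zero]

theorem SplitExtension.sub_mem_range {x x' : L} (hx : π x = π x') : x - x' ∈ J :=
  (h.π_eq_zero_iff _).1 (by rw [map_sub, hx, sub_self])

theorem SplitExtension.ins_congr {p : ℕ} {f : Tot F L M} (hf : f ∈ filt M J (p + 1)) {x x' : L}
    (hx : π x = π x') : ins x f = ins x' f := by
  rw [← sub_eq_zero, ← LinearMap.sub_apply, ← map_sub]
  exact (mem_filt_succ.1 hf).1 _ (h.sub_mem_range hx)

theorem primitive_mem_filt (p : ℕ) (f : Tot F L M) :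
    primitive ι π s τ q η p f ∈ filt M J p := by
  induction p generalizing f with
  | zero => exact mem_filt_zero _
  | succ p ih =>
    refine mem_filt_succ.2 ⟨fun y hy => ?_, fun x => ?_⟩
    · rw [ins_primitive_succ, (h.π_eq_zero_iff _).2 hy]
      simp
    · rw [ins_primitive_succ]
      exact neg_mem (ih _)

theorem ofSymbol_mem_filt (p : ℕ) (ξ : CL F Q (I →ₗ[F] N) p) :
    ofSymbol (M := M) π τ q μ p ξ ∈ filt M J p := by
  induction p with
  | zero => exact mem_filt_zero _
  | succ p ih =>
    refine mem_filt_succ.2 ⟨fun y hy => ?_, fun x => ?_⟩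
    · rw [ins_ofSymbol_succ, (h.π_eq_zero_iff _).2 hy]
      simp
    · rw [ins_ofSymbol_succ]
      exact ih _

theorem dTot_ins_mem {p : ℕ} {f : Tot F L M} (hf : f ∈ filt M J (p + 1))
    (hdf : dTot (B.comap π) f ∈ filt M J (p + 2)) (x : L) :
    dTot (B.comap π) (ins x f) ∈ filt M J (p + 1) := by
  have := ins_dTot (B.comap π) x f
  rw [add_comm, ← add_sub_assoc, eq_sub_iff_add_eq, ← eq_sub_iff_add_eq'] at this
  rw [this]
  exact sub_mem (add_mem (cartanDefect_mem _ x f _) (lieTot_mem h.isNegligible x hf))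
    ((mem_filt_succ.1 hdf).2 x)

theorem coboundary_ins_eq_zero {f : Tot F L M} (hdf : dTot (B.comap π) f ∈ filt M J 1) (y : I) :
    coboundary (B.comap π) q (ins (ι y) f q) = 0 := by
  have := (mem_filt_succ.1 hdf).1 _ ⟨y, rfl⟩
  rw [ins_dTot_of_mem h.isNegligible ⟨y, rfl⟩, neg_eq_zero] at this
  rw [← dTot_succ, this]
  rfl

/-- `ofSymbol` yields cochains representing elements of the first page. -/
theorem dTot_ofSymbol_mem (hN : CohomologyModel (B.comap π) q κ μ η) (p : ℕ)
    (ξ : CL F Q (I →ₗ[F] N) p) :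
    dTot (B.comap π) (ofSymbol π τ q μ p ξ) ∈ filt M J (p + 1) := by
  induction p with
  | zero =>
    refine mem_filt_succ.2 ⟨fun y hy => ?_, fun x => mem_filt_zero _⟩
    rw [ins_dTot_of_mem h.isNegligible hy, ins_ofSymbol_zero, dTot_inDegree, hN.coboundary_μ,
      map_zero, neg_zero]
  | succ p ih =>
    refine mem_filt_succ.2 ⟨fun y hy => ?_, fun x => ?_⟩
    · rw [ins_dTot_of_mem h.isNegligible hy, ins_ofSymbol_succ, (h.π_eq_zero_iff _).2 hy]
      simp
    · rw [ins_dTot, ins_ofSymbol_succ]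
      exact add_mem (sub_mem (lieTot_mem h.isNegligible x (ofSymbol_mem_filt h _ ξ)) (ih _))
        (cartanDefect_mem _ x _ _)

/-- The symbol map is surjective on the first page. -/
theorem symbol_ofSymbol (hN : CohomologyModel (B.comap π) q κ μ η) (p : ℕ)
    (ξ : CL F Q (I →ₗ[F] N) p) : symbol ι s q κ p (ofSymbol π τ q μ p ξ) = ξ := by
  induction p with
  | zero =>
    ext v y
    rw [symbol_zero_apply, ins_ofSymbol_zero, inDegree_same, hN.κ_μ, h.τ_ι,
      Subsingleton.elim v 0]
  | succ p ih =>
    refine curryLeft_injective fun a => ?_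
    rw [curryLeft_symbol_succ, ins_ofSymbol_succ, h.π_s, ih]

/-- Elements which vanish on the first page have symbol zero. -/
theorem symbol_dTot_eq_zero (hN : CohomologyModel (B.comap π) q κ μ η) (p : ℕ) {g : Tot F L M}
    (hg : g ∈ filt M J p) : symbol ι s q κ p (dTot (B.comap π) g) = 0 := by
  induction p generalizing g with
  | zero =>
    ext v y
    rw [symbol_zero_apply, ins_dTot_of_mem h.isNegligible ⟨y, rfl⟩, Pi.neg_apply, map_neg,
      hN.κ_coboundary (dTot_mem_coboundaries _ _ q)]
    simp
  | succ p ih =>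
    refine curryLeft_injective fun a => ?_
    rw [curryLeft_symbol_succ, ins_dTot, map_add, map_sub, ih ((mem_filt_succ.1 hg).2 _),
      symbol_eq_zero p (lieTot_mem h.isNegligible _ hg),
      symbol_eq_zero p (cartanDefect_mem _ _ g _)]
    simp
    rfl

/-- The symbol map is injective on the first page. -/
theorem sub_dTot_primitive_mem (hN : CohomologyModel (B.comap π) q κ μ η) (p : ℕ) {f : Tot F L M}
    (hf : f ∈ filt M J p) (hdf : dTot (B.comap π) f ∈ filt M J (p + 1))
    (hdeg : f ∈ homog F L M (q + p + 1)) (hσ : symbol ι s q κ p f = 0) :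
    f - dTot (B.comap π) (primitive ι π s τ q η p f) ∈ filt M J (p + 1) := by
  induction p generalizing f with
  | zero =>
    refine mem_filt_succ.2 ⟨?_, fun x => mem_filt_zero _⟩
    rintro _ ⟨y, rfl⟩
    have h1 : ins (ι y) f ∈ homog F L M q := ins_mem_homog (by simpa using hdeg) _
    have h2 : κ (ins (ι y) f q) = 0 := by
      rw [← symbol_zero_apply (s := s) f 0 y, hσ]
      simp
    rw [map_sub, ins_dTot_of_mem h.isNegligible ⟨y, rfl⟩, ins_primitive_zero, h.τ_ι, map_neg,
      hN.dTot_η (coboundary_ins_eq_zero h hdf y) h2, inDegree_of_mem_homog h1, neg_neg, sub_self]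
  | succ p ih =>
    have hP := primitive_mem_filt (q := q) (η := η) h (p + 1) f
    have hmem : f - dTot (B.comap π) (primitive ι π s τ q η (p + 1) f) ∈ filt M J (p + 1) :=
      sub_mem hf (dTot_mem h.isNegligible hP)
    refine mem_filt_succ.2 ⟨(mem_filt_succ.1 hmem).1, fun x => ?_⟩
    rw [h.ins_congr hmem (h.π_s (π x)).symm, map_sub, ins_dTot, ins_primitive_succ, h.π_s, map_neg,
      sub_neg_eq_add]
    -- The Lie derivative and the defect in Cartan's formula lie in the step `p + 1` already.
    have h1 := ih ((mem_filt_succ.1 hf).2 (s (π x))) (dTot_ins_mem h hf hdf _)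
      (ins_mem_homog (by rw [add_assoc (q : ℤ)]; exact_mod_cast hdeg) _) (by
        rw [← curryLeft_symbol_succ, hσ]
        rfl)
    have h2 := add_mem (lieTot_mem (h.isNegligible (B := B)) (s (π x)) hP)
      (cartanDefect_mem (B.comap π) (s (π x)) (primitive ι π s τ q η (p + 1) f) (p + 1))
    convert sub_mem h1 h2 using 1
    abel

section Action

variable {C : LeftModule F Q N}
  (hC : ∀ (x : L) (c : CL F L M q), coboundary (B.comap π) q c = 0 →
    κ (lieDer (B.comap π).toLeftModule q x c) = C.left (π x) (κ c))
include hC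

/-- The symbol intertwines the Lie derivatives of `L` and of `Q`. -/
theorem symbol_lieTot (p : ℕ) (x : L) {f : Tot F L M} (hf : f ∈ filt M J p)
    (hdf : dTot (B.comap π) f ∈ filt M J (p + 1)) :
    symbol ι s q κ p (lieTot (B.comap π).toLeftModule x f) =
      lieDer (A.hom C) p (π x) (symbol ι s q κ p f) := by
  induction p generalizing f with
  | zero =>
    ext v y
    rw [symbol_zero_apply, ins_lieTot, Pi.sub_apply, map_sub, lieTot_apply,
      hC _ _ (coboundary_ins_eq_zero h hdf y), lieDer_zero_apply, ← h.ι_left]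
    rfl
  | succ p ih =>
    refine curryLeft_injective fun a => ?_
    -- `x (s a)` and `s (π x · a)` differ by an element of `J`, on which the insertion vanishes.
    have hx : π (x * s a) = π (s (π x * a)) := by rw [h.π_s, map_mul, h.π_s]
    rw [curryLeft_symbol_succ, ins_lieTot, map_sub, curryLeft_lieDer, curryLeft_symbol_succ,
      curryLeft_symbol_succ, ih ((mem_filt_succ.1 hf).2 _) (dTot_ins_mem h hf hdf _),
      h.ins_congr hf hx]

/-- The symbol turns the differential of the first page into the coboundary for the symmetric
bimodule `Hom(I, N)_s`. -/
theorem symbol_dTot (hN : CohomologyModel (B.comap π) q κ μ η) (p : ℕ) {f : Tot F L M}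
    (hf : f ∈ filt M J p) (hdf : dTot (B.comap π) f ∈ filt M J (p + 1)) :
    symbol ι s q κ (p + 1) (dTot (B.comap π) f) =
      coboundary (A.hom C).symm p (symbol ι s q κ p f) := by
  refine curryLeft_injective fun a => ?_
  rw [curryLeft_symbol_succ, ins_dTot, map_add, map_sub, symbol_lieTot h hC p _ hf hdf,
    symbol_eq_zero p (cartanDefect_mem _ _ f _), h.π_s, add_zero]
  cases p with
  | zero =>
    ext v : 1
    rw [symbol_dTot_eq_zero h hN 0 (mem_filt_zero _), curryLeft_coboundary_zero, sub_zero,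
      lieDer_zero_apply]
    simp [LeftModule.symm]
  | succ p =>
    rw [curryLeft_coboundary, curryLeft_symbol_succ,
      ← symbol_dTot hN p ((mem_filt_succ.1 hf).2 _) (dTot_ins_mem h hf hdf _)]
    rfl

end Action

end Symbol
section Assembly

variable {F : Type uF} [Field F]
variable {I : Type uI} [AddCommGroup I] [Module F I]
variable {L : Type uL} [NonUnitalNonAssocRing L] [Module F L]
  [IsScalarTower F L L] [SMulCommClass F L L] [IsLeftLeibniz L]
variable {Q : Type uQ} [NonUnitalNonAssocRing Q] [Module F Q]
  [IsScalarTower F Q Q] [SMulCommClass F Q Q]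
variable {M : Type uM} [AddCommGroup M] [Module F M]
variable {N : Type uN} [AddCommGroup N] [Module F N]
variable {ι : I →ₗ[F] L} {π : L →ₙₐ[F] Q} {A : LeftModule F Q I}
  {s : Q →ₗ[F] L} {τ : L →ₗ[F] I} {B : Bimodule F Q M} {q : ℕ}
  {κ : CL F L M q →ₗ[F] N} {μ : N →ₗ[F] CL F L M q} {η : CL F L M q →ₗ[F] Tot F L M}

local notation "J" => LinearMap.range ι

/-! ### The second page for the relative complex -/

theorem mk_mem_relFiltered_G (h : IsNegligible J (B.comap π)) {p n : ℤ} {f : Tot F L M}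
    (hf : Submodule.Quotient.mk f ∈ (relFiltered h).G p n) : f ∈ filt M J p.toNat := by
  obtain ⟨g, hg, hfg⟩ := hf
  rw [Submodule.mkQ_apply, eq_comm, ← sub_eq_zero, ← Submodule.Quotient.mk_sub,
    Submodule.Quotient.mk_eq_zero] at hfg
  simpa using add_mem (mem_negligible.1 hfg p.toNat) hg.1

/-- The second page, in terms of any left module structure on `N` induced by the Lie derivatives. -/
theorem nonempty_relFiltered_page_two (h : SplitExtension ι π A s τ)
    (hN : CohomologyModel (B.comap π) q κ μ η) {C : LeftModule F Q N}
    (hC : ∀ (x : L) (c : CL F L M q), coboundary (B.comap π) q c = 0 →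
      κ (lieDer (B.comap π).toLeftModule q x c) = C.left (π x) (κ c)) (p : ℕ) :
    Nonempty ((relFiltered (h.isNegligible (B := B))).Page 2 p (p + q) ≃ₗ[F]
      HL (A.hom C).symm p) := by
  have hZ (p : ℕ) {x} (hx : x ∈ (relFiltered (h.isNegligible (B := B))).Z 1 p (p + q)) :
      ∃ f, f ∈ filt M J p ∧ dTot (B.comap π) f ∈ filt M J (p + 1) ∧
        f ∈ homog F L M (q + p + 1) ∧ Submodule.Quotient.mk f = x := by
    obtain ⟨⟨f, ⟨hf, hdeg⟩, rfl⟩, hx⟩ := hx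
    refine ⟨f, by simpa using hf, mk_mem_relFiltered_G (h.isNegligible (B := B)) hx, ?_, rfl⟩
    rwa [add_comm (q : ℤ)]
  let σ (p : ℕ) : (Tot F L M ⧸ negligible M J) →ₗ[F] CL F Q (I →ₗ[F] N) p :=
    Submodule.liftQ _ (symbol ι s q κ p) fun f hf => symbol_eq_zero p (mem_negligible.1 hf _)
  refine FilteredDifferential.nonempty_page_two_equiv (coboundary (A.hom C).symm) q σ ?_ ?_ ?_ p
  · intro p x hx
    obtain ⟨f, hf, hdf, hdeg, rfl⟩ := hZ p hx
    rw [FilteredDifferential.mem_N]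
    constructor
    · intro hσ
      have hdeg' := primitive_mem_homog (ι := ι) (π := π) (s := s) (τ := τ) hN p f
      refine ⟨_, ⟨f - dTot (B.comap π) (primitive ι π s τ q η p f),
        ⟨sub_dTot_primitive_mem h hN p hf hdf hdeg hσ, ?_⟩, rfl⟩, Submodule.Quotient.mk
          (primitive ι π s τ q η p f), ⟨_, ⟨?_, ?_⟩, rfl⟩, ⟨dTot (B.comap π)
          (primitive ι π s τ q η p f), ⟨?_, ?_⟩, rfl⟩, ?_⟩
      · rw [add_comm (p : ℤ)]
        exact sub_mem hdeg (dTot_mem_homog _ hdeg')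
      · simpa using primitive_mem_filt h p f
      · rw [sub_add_cancel, add_comm (p : ℤ)]
        exact hdeg'
      · simpa using dTot_mem h.isNegligible (primitive_mem_filt h p f)
      · rw [add_comm (p : ℤ)]
        exact dTot_mem_homog _ hdeg'
      · exact (congrArg (Submodule.mkQ (negligible M J)) (sub_add_cancel _ _))
    · rintro ⟨_, ⟨u, hu, rfl⟩, _, ⟨g, hg, rfl⟩, -, hfg⟩
      rw [← hfg, map_add]
      have hg' : g ∈ filt M J p := by simpa using hg.1
      have h1 : symbol ι s q κ p u = 0 := symbol_eq_zero p hu.1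
      have h2 : symbol ι s q κ p (dTot (B.comap π) g) = 0 := symbol_dTot_eq_zero h hN p hg'
      change symbol ι s q κ p u + symbol ι s q κ p (dTot (B.comap π) g) = 0
      rw [h1, h2, add_zero]
  · intro p ξ
    refine ⟨Submodule.Quotient.mk (ofSymbol π τ q μ p ξ), ⟨⟨_, ⟨?_, ?_⟩, rfl⟩,
      ⟨dTot (B.comap π) (ofSymbol π τ q μ p ξ), ⟨dTot_ofSymbol_mem h hN p ξ, ?_⟩, rfl⟩⟩,
      symbol_ofSymbol h hN p ξ⟩
    · simpa using ofSymbol_mem_filt h p ξ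
    · rw [add_comm (p : ℤ)]
      exact ofSymbol_mem_homog p ξ
    · rw [add_comm (p : ℤ)]
      exact dTot_mem_homog _ (ofSymbol_mem_homog p ξ)
  · intro p x hx
    obtain ⟨f, hf, hdf, -, rfl⟩ := hZ p hx
    exact symbol_dTot h hC hN p hf hdf

/-! ### Convergence to the relative cohomology -/

theorem inDegree_pullback_mem (h : SplitExtension ι π A s τ) (n : ℕ) (g : CL F Q M n) :
    inDegree F L M n (pullback π n g) ∈ negligible M J := by
  refine mem_negligible.2 fun p => ?_
  induction p generalizing n with
  | zero => exact mem_filt_zero _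
  | succ p ih =>
    cases n with
    | zero =>
      refine mem_filt_succ.2 ⟨fun y _ => ins_inDegree_zero _ _, fun x => ?_⟩
      rw [ins_inDegree_zero]
      exact zero_mem _
    | succ n =>
      have key (x : L) : (pullback π (n + 1) g).curryLeft x = pullback π n (g.curryLeft (π x)) := by
        ext v
        simp only [MultilinearMap.curryLeft_apply, pullback_apply]
        congr 1
        funext k
        refine Fin.cases ?_ (fun k => ?_) k <;> simp
      refine mem_filt_succ.2 ⟨fun y hy => ?_, fun x => ?_⟩
      · rw [ins_inDegree_succ, key, (h.π_eq_zero_iff _).2 hy]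
        simp
      · rw [ins_inDegree_succ, key]
        exact ih n _

theorem pullback_compLinearMap (h : SplitExtension ι π A s τ) (n : ℕ) {f : CL F L M n}
    (hf : inDegree F L M n f ∈ filt M J n) :
    pullback π n (f.compLinearMap fun _ => s) = f := by
  induction n with
  | zero =>
    ext v
    simp [Subsingleton.elim _ v]
  | succ n ih =>
    refine curryLeft_injective fun x => ?_
    have h1 := (mem_filt_succ.1 hf).2 (s (π x))
    rw [ins_inDegree_succ] at h1
    have h2 : f.curryLeft x = f.curryLeft (s (π x)) := by
      have := h.ins_congr hf (h.π_s (π x)).symm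
      rw [ins_inDegree_succ, ins_inDegree_succ] at this
      simpa using congrFun this n
    rw [h2, ← ih h1]
    ext v
    simp only [MultilinearMap.curryLeft_apply, pullback_apply, MultilinearMap.compLinearMap_apply]
    congr 1
    funext k
    refine Fin.cases ?_ (fun k => ?_) k <;> simp

/-- The negligible cochains are those induced from `Q`. -/
theorem inDegree_mem_negligible_iff (h : SplitExtension ι π A s τ) {n : ℕ} (f : CL F L M n) :
    inDegree F L M n f ∈ negligible M J ↔ f ∈ LinearMap.range (pullback (M := M) π n) := by
  constructor
  · intro hf
    exact ⟨_, pullback_compLinearMap h n (mem_negligible.1 hf n)⟩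
  · rintro ⟨g, rfl⟩
    exact inDegree_pullback_mem h n g

theorem relFiltered_convergesTo (h : SplitExtension ι π A s τ) :
    ConvergesTo (relFiltered (h.isNegligible (B := B))).spectralSequence (relHL B π) := by
  let ε (n : ℕ) : relCL M π n →ₗ[F] Tot F L M ⧸ negligible M J :=
    Submodule.liftQ _ (Submodule.mkQ _ ∘ₗ inDegree F L M (n + 1)) fun f hf =>
      (Submodule.Quotient.mk_eq_zero _).2 ((inDegree_mem_negligible_iff h f).2 hf)
  refine FilteredDifferential.convergesTo (d := relCoboundary B π) ε (fun n => ?_) (fun n => ?_)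
    fun n v => ?_
  · rw [← LinearMap.ker_eq_bot, LinearMap.ker_eq_bot']
    intro v hv
    obtain ⟨f, rfl⟩ := Submodule.mkQ_surjective _ v
    exact (Submodule.Quotient.mk_eq_zero _).2
      ((inDegree_mem_negligible_iff h f).1 ((Submodule.Quotient.mk_eq_zero _).1 hv))
  · ext x
    constructor
    · rintro ⟨v, rfl⟩
      obtain ⟨f, rfl⟩ := Submodule.mkQ_surjective _ v
      exact ⟨inDegree F L M (n + 1) f,
        ⟨mem_filt_zero _, by exact_mod_cast inDegree_mem_homog f⟩, rfl⟩
    · rintro ⟨f, ⟨-, hf⟩, rfl⟩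
      refine ⟨Submodule.mkQ _ (f (n + 1)), ?_⟩
      have : inDegree F L M (n + 1) (f (n + 1)) = f :=
        inDegree_of_mem_homog (by exact_mod_cast hf)
      exact congrArg (Submodule.mkQ _) this
  · obtain ⟨f, rfl⟩ := Submodule.mkQ_surjective _ v
    exact congrArg (Submodule.mkQ (negligible M J)) (dTot_inDegree _ f)

/-! ### The action on cohomology -/

/-- Over a field, representatives and primitives of classes can be chosen linearly, and the class
map can be extended to all cochains. -/
theorem exists_cohomologyModel (B : Bimodule F L M) (q : ℕ) :
    ∃ (κ : CL F L M q →ₗ[F] HL B q) (μ : HL B q →ₗ[F] CL F L M q)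
      (η : CL F L M q →ₗ[F] Tot F L M), CohomologyModel B q κ μ η ∧
      ∀ c : LinearMap.ker (coboundary B q), κ c = Submodule.Quotient.mk c := by
  obtain ⟨r, hr⟩ := LinearMap.exists_leftInverse_of_injective
    (LinearMap.ker (coboundary B q)).subtype (Submodule.ker_subtype _)
  obtain ⟨μ, hμ⟩ := LinearMap.exists_rightInverse_of_surjective
    ((coboundaries (coboundary B) q).submoduleOf (LinearMap.ker (coboundary B q))).mkQ
    (Submodule.range_mkQ _)
  have hr' (c : LinearMap.ker (coboundary B q)) : r c = c := LinearMap.congr_fun hr c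
  have hμ' (z : HL B q) : Submodule.mkQ _ (μ z) = z := LinearMap.congr_fun hμ z
  have hη : ∃ η : CL F L M q →ₗ[F] Tot F L M, (∀ c, η c ∈ homog F L M ((q : ℤ) - 1)) ∧
      ∀ c ∈ coboundaries (coboundary B) q, dTot B (η c) = inDegree F L M q c := by
    cases q with
    | zero =>
      -- The only coboundary of degree `0` is zero.
      refine ⟨0, fun c => zero_mem _, fun c hc => ?_⟩
      rw [(Submodule.mem_bot F).1 hc]
      simp
    | succ q =>
      obtain ⟨g, hg⟩ := LinearMap.exists_rightInverse_of_surjective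
        (coboundary B q).rangeRestrict (LinearMap.range_rangeRestrict _)
      obtain ⟨t, ht⟩ := LinearMap.exists_leftInverse_of_injective
        (LinearMap.range (coboundary B q)).subtype (Submodule.ker_subtype _)
      refine ⟨inDegree F L M q ∘ₗ g ∘ₗ t, fun c => ?_, fun c hc => ?_⟩
      · have := inDegree_mem_homog (F := F) (L := L) (M := M) (g (t c))
        simpa using this
      · have h1 : t c = ⟨c, hc⟩ := LinearMap.congr_fun ht ⟨c, hc⟩
        have h2 : coboundary B q (g ⟨c, hc⟩) = c :=
          congrArg Subtype.val (LinearMap.congr_fun hg ⟨c, hc⟩)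
        rw [LinearMap.comp_apply, LinearMap.comp_apply, h1, dTot_inDegree, h2]
  obtain ⟨η, hη1, hη2⟩ := hη
  have hcob {c : CL F L M q} (hc : c ∈ coboundaries (coboundary B) q) : coboundary B q c = 0 := by
    cases q with
    | zero => rw [(Submodule.mem_bot F).1 hc, map_zero]
    | succ q =>
      obtain ⟨g, rfl⟩ := hc
      exact coboundary_coboundary B q g
  have hκ (c : LinearMap.ker (coboundary B q)) : (Submodule.mkQ _ ∘ₗ r) (c : CL F L M q) =
      (Submodule.Quotient.mk c : HL B q) := congrArg (Submodule.mkQ _) (hr' c)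
  refine ⟨Submodule.mkQ _ ∘ₗ r, Submodule.subtype _ ∘ₗ μ, η, ⟨fun {c} hc => ?_, fun z => (μ z).2,
    fun z => ?_, hη1, fun {c} hc hc' => hη2 c ?_⟩, hκ⟩
  · rw [hκ ⟨c, hcob hc⟩]
    exact (Submodule.Quotient.mk_eq_zero _).2 hc
  · exact (hκ (μ z)).trans (hμ' z)
  · rw [hκ ⟨c, hc⟩] at hc'
    exact (Submodule.Quotient.mk_eq_zero ((coboundaries (coboundary B) q).submoduleOf _)).1 hc'

/-- Lie derivatives of cocycles are cocycles. -/
theorem lieDer_mem_ker_coboundary (B : Bimodule F L M) (x : L)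
    (c : LinearMap.ker (coboundary B q)) :
    lieDer B.toLeftModule q x c ∈ LinearMap.ker (coboundary B q) := by
  rw [LinearMap.mem_ker, ← lieDer_coboundary, c.2, map_zero]

/-- `L` acts trivially on its cohomology in positive degrees: by Cartan's formula the
Lie derivative of a cocycle `c` is the coboundary of an insertion. -/
theorem mk_lieDer_eq_zero (B : Bimodule F L M) (x : L)
    (c : LinearMap.ker (coboundary B (q + 1))) :
    (Submodule.Quotient.mk ⟨_, lieDer_mem_ker_coboundary B x c⟩ : HL B (q + 1)) = 0 := by
  refine (Submodule.Quotient.mk_eq_zero _).2 ⟨(c : CL F L M (q + 1)).curryLeft x, ?_⟩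
  have h := curryLeft_coboundary B (c : CL F L M (q + 1)) x
  rw [LinearMap.mem_ker.1 c.2] at h
  exact (sub_eq_zero.1 h.symm).symm

/-- In degree `0`, the Lie derivative induces the given action on the invariants. -/
theorem mk_lieDer_zero (hπ : Function.Surjective π) (x : L)
    (c : LinearMap.ker (coboundary (B.comap π) 0)) :
    (Submodule.Quotient.mk ⟨_, lieDer_mem_ker_coboundary (B.comap π) x c⟩ : HL (B.comap π) 0) =
      (HLzeroLeftModule B π hπ).left (π x) (Submodule.Quotient.mk c) := by
  refine (HLzeroEquiv (B.comap π)).injective ?_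
  simp only [HLzeroLeftModule, LeftModule.transport, LinearMap.mk₂_apply,
    LinearEquiv.apply_symm_apply]
  ext
  exact lieDer_zero_apply (B.comap π).toLeftModule x (c : CL F L M 0) 0

end Assembly

/-! ### Cohomology with trivial coefficients as the dual of homology -/

section Duality

theorem nonempty_cohomology_congr {F : Type*} [Field F] {C : ℕ → Type*} {C' : ℕ → Type*}
    [∀ n, AddCommGroup (C n)] [∀ n, Module F (C n)]
    [∀ n, AddCommGroup (C' n)] [∀ n, Module F (C' n)]
    {d : ∀ n, C n →ₗ[F] C (n + 1)} {d' : ∀ n, C' n →ₗ[F] C' (n + 1)} (e : ∀ n, C n ≃ₗ[F] C' n)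
    (he : ∀ n x, e (n + 1) (d n x) = d' n (e n x)) (n : ℕ) :
    Nonempty (Cohomology d n ≃ₗ[F] Cohomology d' n) := by
  have hker (x : LinearMap.ker (d n)) : e n x ∈ LinearMap.ker (d' n) := by
    rw [LinearMap.mem_ker, ← he, x.2, map_zero]
  refine nonempty_equiv_of_surjective (Submodule.mkQ _)
    (Submodule.mkQ _ ∘ₗ ((e n).toLinearMap ∘ₗ Submodule.subtype _).codRestrict _ hker)
    (Submodule.mkQ_surjective _) ?_ fun x => ?_
  · intro y
    obtain ⟨⟨c, hc⟩, rfl⟩ := Submodule.mkQ_surjective _ y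
    refine ⟨⟨(e n).symm c, ?_⟩, congrArg (Submodule.mkQ _) (Subtype.ext ?_)⟩
    · rw [LinearMap.mem_ker, ← (e (n + 1)).map_eq_zero_iff, he, LinearEquiv.apply_symm_apply]
      exact hc
    · exact (e n).apply_symm_apply c
  · rw [Submodule.mkQ_apply, Submodule.Quotient.mk_eq_zero, LinearMap.comp_apply,
      Submodule.mkQ_apply, Submodule.Quotient.mk_eq_zero]
    obtain ⟨x, hx⟩ := x
    change x ∈ coboundaries d n ↔ e n x ∈ coboundaries d' n
    cases n with
    | zero => exact (e 0).map_eq_zero_iff.symm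
    | succ n =>
      constructor
      · rintro ⟨w, rfl⟩
        exact ⟨e n w, (he n w).symm⟩
      · rintro ⟨w, hw⟩
        refine ⟨(e n).symm w, (e (n + 1)).injective ?_⟩
        rw [he, LinearEquiv.apply_symm_apply, hw]

/-- The universal coefficient theorem over a field. -/
theorem nonempty_cohomology_dual {F : Type*} [Field F] {C : ℕ → Type uM}
    [∀ n, AddCommGroup (C n)] [∀ n, Module F (C n)] (b : ∀ n, C (n + 1) →ₗ[F] C n)
    (N : Type uN) [AddCommGroup N] [Module F N] (n : ℕ) :
    Nonempty (Cohomology (C := fun n => C n →ₗ[F] N) (fun n => LinearMap.lcomp F N (b n)) n ≃ₗ[F]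
      (Homology b n →ₗ[F] N)) := by
  let d : ∀ n, (C n →ₗ[F] N) →ₗ[F] (C (n + 1) →ₗ[F] N) := fun n => LinearMap.lcomp F N (b n)
  have hd (φ : LinearMap.ker (d n)) (c : C (n + 1)) : (φ : C n →ₗ[F] N) (b n c) = 0 :=
    LinearMap.congr_fun (LinearMap.mem_ker.1 φ.2) c
  let g : LinearMap.ker (d n) →ₗ[F] (Homology b n →ₗ[F] N) :=
    { toFun := fun φ => Submodule.liftQ _ ((φ : C n →ₗ[F] N) ∘ₗ Submodule.subtype _) (by
        rintro ⟨z, hz⟩ ⟨c, hc⟩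
        exact (congrArg _ hc.symm).trans (hd φ c))
      map_add' := fun φ ψ => by
        ext
        rfl
      map_smul' := fun c φ => by
        ext
        rfl }
  refine nonempty_equiv_of_surjective (Submodule.mkQ _) g (Submodule.mkQ_surjective _) ?_
    fun φ => ?_
  · intro ψ
    let m : Homology b n →ₗ[F] C n ⧸ LinearMap.range (b n) :=
      Submodule.mapQ _ _ (Submodule.subtype _) le_rfl
    have hm : LinearMap.ker m = ⊥ := by
      rw [LinearMap.ker_eq_bot']
      intro z hz
      obtain ⟨z, rfl⟩ := Submodule.mkQ_surjective _ z
      exact (Submodule.Quotient.mk_eq_zero _).2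
        ((Submodule.Quotient.mk_eq_zero (LinearMap.range (b n))).1 hz)
    obtain ⟨t, ht⟩ := LinearMap.exists_leftInverse_of_injective m hm
    refine ⟨⟨ψ ∘ₗ t ∘ₗ Submodule.mkQ _, ?_⟩, ?_⟩
    · rw [LinearMap.mem_ker]
      ext c
      change ψ (t (Submodule.mkQ _ (b n c))) = 0
      have : Submodule.mkQ (LinearMap.range (b n)) (b n c) = 0 :=
        (Submodule.Quotient.mk_eq_zero _).2 ⟨c, rfl⟩
      rw [this, map_zero, map_zero]
    · refine LinearMap.ext fun z => ?_
      obtain ⟨z, rfl⟩ := Submodule.mkQ_surjective _ z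
      exact congrArg ψ (LinearMap.congr_fun ht (Submodule.mkQ _ z))
  · rw [Submodule.mkQ_apply, Submodule.Quotient.mk_eq_zero]
    have hg : g φ = 0 ↔ ∀ z ∈ cycles b n, (φ : C n →ₗ[F] N) z = 0 := by
      constructor
      · intro h z hz
        exact LinearMap.congr_fun h (Submodule.Quotient.mk ⟨z, hz⟩)
      · intro h
        refine LinearMap.ext fun z => ?_
        obtain ⟨z, rfl⟩ := Submodule.mkQ_surjective _ z
        exact h z z.2
    rw [hg]
    obtain ⟨φ, hφ⟩ := φ
    change φ ∈ coboundaries (C := fun n => C n →ₗ[F] N) d n ↔ _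
    cases n with
    | zero =>
      constructor
      · intro h z _
        exact LinearMap.congr_fun ((Submodule.mem_bot F).1 h) z
      · intro h
        exact (Submodule.mem_bot F).2 (LinearMap.ext fun z => h z trivial)
    | succ n =>
      constructor
      · rintro ⟨ψ, rfl⟩ z hz
        change ψ (b n z) = 0
        rw [LinearMap.mem_ker.1 hz, map_zero]
      · intro h
        obtain ⟨g, hg⟩ := LinearMap.exists_rightInverse_of_surjective
          (b n).rangeRestrict (LinearMap.range_rangeRestrict _)
        obtain ⟨t, ht⟩ := LinearMap.exists_leftInverse_of_injective
          (LinearMap.range (b n)).subtype (Submodule.ker_subtype _)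
        refine ⟨φ ∘ₗ g ∘ₗ t, LinearMap.ext fun z => ?_⟩
        have h1 : t (b n z) = (b n).rangeRestrict z :=
          LinearMap.congr_fun ht ((b n).rangeRestrict z)
        have h2 : b n (g ((b n).rangeRestrict z)) = b n z :=
          congrArg Subtype.val (LinearMap.congr_fun hg ((b n).rangeRestrict z))
        change φ (g (t (b n z))) = φ z
        rw [h1, ← sub_eq_zero, ← map_sub]
        refine h _ (LinearMap.mem_ker.2 ?_)
        rw [map_sub, h2, sub_self]

variable {F : Type uF} [Field F]
variable {Q : Type uQ} [NonUnitalNonAssocRing Q] [Module F Q]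
  [IsScalarTower F Q Q] [SMulCommClass F Q Q]
variable {I : Type uI} [AddCommGroup I] [Module F I]
variable {N : Type uN} [AddCommGroup N] [Module F N]

/-- The trivial left module. -/
def LeftModule.trivial : LeftModule F Q N where
  left := 0
  left_mul := by simp

variable (F Q I N) in
/-- Cochains with values in `Hom(I, N)` are linear maps out of the chains with values in `I`. -/
noncomputable def cochainsEquivDual (n : ℕ) :
    CL F Q (I →ₗ[F] N) n ≃ₗ[F] (chains F Q I n →ₗ[F] N) :=
  (PiTensorProduct.lift (R := F) (s := fun _ : Fin n => Q)).trans
    (TensorProduct.lift.equiv (.id F) (⨂[F] _ : Fin n, Q) I N)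

theorem cochainsEquivDual_tmul (n : ℕ) (f : CL F Q (I →ₗ[F] N) n) (x : Fin n → Q) (y : I) :
    cochainsEquivDual F Q I N n f (PiTensorProduct.tprod F x ⊗ₜ y) = f x y := by
  simp [cochainsEquivDual]

/-- For trivial coefficients `N`, the coboundary with values in `Hom(I, N)_s` is the transpose of the
boundary with values in `I_s`. -/
theorem cochainsEquivDual_coboundary (A : LeftModule F Q I) (n : ℕ) (f : CL F Q (I →ₗ[F] N) n) :
    cochainsEquivDual F Q I N (n + 1)
        (coboundary (A.hom (LeftModule.trivial (N := N))).symm n f) =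
      cochainsEquivDual F Q I N n f ∘ₗ boundary A n := by
  ext x y
  have h1 (a : Q) (g : I →ₗ[F] N) :
      (A.hom (LeftModule.trivial (N := N))).left a g = -(g ∘ₗ A.left a) := by
    ext
    simp [LeftModule.hom, LeftModule.trivial]
  simp only [LinearMap.compMultilinearMap_apply, TensorProduct.AlgebraTensorModule.curry_apply,
    LinearMap.restrictScalars_self, TensorProduct.curry_apply, LinearMap.comp_apply,
    cochainsEquivDual_tmul, boundary_tmul, coboundary_apply, map_add, map_sum, map_smul,
    apply_ite (cochainsEquivDual F Q I N n f), map_zero]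
  rw [Fin.sum_univ_castSucc (fun i : Fin (n + 1) =>
    (-1 : F) ^ ((i : ℕ) + 1) • f (i.removeNth x) (A.left (x i) y))]
  simp [LeftModule.symm, h1, LinearMap.sum_apply, apply_ite (fun g : I →ₗ[F] N => g y), pow_succ]

theorem nonempty_HL_trivial_equiv (A : LeftModule F Q I) (n : ℕ) :
    Nonempty (HL (A.hom (LeftModule.trivial (N := N))).symm n ≃ₗ[F] (HLhomology A n →ₗ[F] N)) := by
  obtain ⟨e⟩ := nonempty_cohomology_congr (d' := fun n => LinearMap.lcomp F N (boundary A n))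
    (cochainsEquivDual F Q I N) (cochainsEquivDual_coboundary A) n
  obtain ⟨e'⟩ := nonempty_cohomology_dual (boundary A) N n
  exact ⟨e.trans e'⟩

end Duality

/-! ### The action on the kernel and the spectral sequence of the extension -/

section Extension

variable {F : Type uF} [Field F]
variable {I : Type uI} [NonUnitalNonAssocRing I] [Module F I]
variable {L : Type uL} [NonUnitalNonAssocRing L] [Module F L]
  [IsScalarTower F L L] [SMulCommClass F L L] [IsLeftLeibniz L]
variable {Q : Type uQ} [NonUnitalNonAssocRing Q] [Module F Q]

/-- The kernel of an extension with left central kernel is an anti-symmetric bimodule, and the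
extension splits linearly. -/
theorem exists_kernel_bimodule (ι : I →ₙₐ[F] L) (π : L →ₙₐ[F] Q) (hι : Function.Injective ι)
    (hex : Function.Exact ι π) (hπ : Function.Surjective π)
    (hcenter : ∀ (y : I) (x : L), ι y * x = 0) :
    ∃ (BI : Bimodule F Q I) (s : Q →ₗ[F] L) (τ : L →ₗ[F] I), BI.IsAntisymmetric ∧
      SplitExtension (ι : I →ₗ[F] L) π BI.toLeftModule s τ := by
  obtain ⟨s, hs⟩ := LinearMap.exists_rightInverse_of_surjective (π : L →ₗ[F] Q)
    (LinearMap.range_eq_top.2 hπ)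
  obtain ⟨τ, hτ⟩ := LinearMap.exists_leftInverse_of_injective (ι : I →ₗ[F] L)
    (LinearMap.ker_eq_bot.2 hι)
  have hs (a : Q) : π (s a) = a := LinearMap.congr_fun hs a
  have hτ (y : I) : τ (ι y) = y := LinearMap.congr_fun hτ y
  have hπι (y : I) : π (ι y) = 0 := (hex _).2 ⟨y, rfl⟩
  have hιτ {x : L} (hx : π x = 0) : ι (τ x) = x := by
    obtain ⟨y, rfl⟩ := (hex x).1 hx
    rw [hτ]
  have hιs (a : Q) (y : I) : ι (τ (s a * ι y)) = s a * ι y :=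
    hιτ (by rw [map_mul, hπι, mul_zero])
  have hmul {x x' : L} (h : π x = π x') (z : L) : x * z = x' * z := by
    obtain ⟨y, hy⟩ := (hex (x - x')).1 (by rw [map_sub, h, sub_self])
    rw [← sub_eq_zero, ← sub_mul, ← hy, hcenter]
  let l : Q →ₗ[F] I →ₗ[F] I := LinearMap.mk₂ F (fun a y => τ (s a * ι y))
    (by intros; simp [add_mul]) (by intros; simp [smul_mul_assoc])
    (by intros; simp [mul_add]) (by intros; simp [mul_smul_comm])
  have hl (a : Q) (y : I) : ι (l a y) = s a * ι y := hιs a y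
  let BI : Bimodule F Q I :=
    { left := l
      left_mul := fun a b y => hι (by
        rw [map_sub, hl, hl, hl, hl, hl, hmul (x' := s a * s b) (by simp [hs]),
          IsLeftLeibniz.leibniz (s a) (s b)]
        abel)
      right := 0
      right_left := by simp
      right_right := by simp }
  refine ⟨BI, s, τ, fun x m => rfl, hs, hτ, fun x => hex x, hcenter, fun x y => ?_⟩
  exact (hl _ _).trans (hmul (hs _) _)

variable [IsScalarTower F Q Q] [SMulCommClass F Q Q]

theorem relFiltered_page_two_zero {M : Type uM} [AddCommGroup M] [Module F M]
    {ι : I →ₗ[F] L} {π : L →ₙₐ[F] Q} {A : LeftModule F Q I} {s : Q →ₗ[F] L} {τ : L →ₗ[F] I}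
    (h : SplitExtension ι π A s τ) (hπ : Function.Surjective π) (B : Bimodule F Q M) (p : ℕ) :
    Nonempty ((relFiltered (h.isNegligible (B := B))).Page 2 p (p + (0 : ℕ)) ≃ₗ[F]
      HL (A.hom (HLzeroLeftModule B π hπ)).symm p) := by
  obtain ⟨κ, μ, η, hN, hκ⟩ := exists_cohomologyModel (B.comap π) 0
  refine nonempty_relFiltered_page_two h hN (fun x c hc => ?_) p
  have h1 := hκ ⟨c, hc⟩
  have h2 := hκ ⟨_, lieDer_mem_ker_coboundary (B.comap π) x ⟨c, hc⟩⟩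
  exact (h2.trans (mk_lieDer_zero hπ x ⟨c, hc⟩)).trans
    (congrArg ((HLzeroLeftModule B π hπ).left (π x)) h1.symm)

theorem relFiltered_page_two_succ {M : Type uM} [AddCommGroup M] [Module F M]
    {ι : I →ₗ[F] L} {π : L →ₙₐ[F] Q} {A : LeftModule F Q I} {s : Q →ₗ[F] L} {τ : L →ₗ[F] I}
    (h : SplitExtension ι π A s τ) (B : Bimodule F Q M) (p q : ℕ) :
    Nonempty ((relFiltered (h.isNegligible (B := B))).Page 2 p (p + (q + 1 : ℕ)) ≃ₗ[F]
      (HLhomology A p →ₗ[F] HL (B.comap π) (q + 1))) := by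
  obtain ⟨κ, μ, η, hN, hκ⟩ := exists_cohomologyModel (B.comap π) (q + 1)
  obtain ⟨e⟩ := nonempty_relFiltered_page_two h hN (C := LeftModule.trivial) (fun x c hc =>
    (hκ ⟨_, lieDer_mem_ker_coboundary (B.comap π) x ⟨c, hc⟩⟩).trans
      (mk_lieDer_eq_zero (B.comap π) x ⟨c, hc⟩)) p
  obtain ⟨e'⟩ := nonempty_HL_trivial_equiv (N := HL (B.comap π) (q + 1)) A p
  exact ⟨e.trans e'⟩

end Extension

end Leibniz

theorem theorem3p2 {F : Type uF} [Field F]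
    {I : Type uI} {L : Type uL} {Q : Type uQ}
    [NonUnitalNonAssocRing I] [Module F I] [IsScalarTower F I I] [SMulCommClass F I I]
    [NonUnitalNonAssocRing L] [Module F L] [IsScalarTower F L L] [SMulCommClass F L L]
    [NonUnitalNonAssocRing Q] [Module F Q] [IsScalarTower F Q Q] [SMulCommClass F Q Q]
    [IsLeftLeibniz I] [IsLeftLeibniz L] [IsLeftLeibniz Q]
    (ι : I →ₙₐ[F] L) (π : L →ₙₐ[F] Q) (hι : Function.Injective ι)
    (hex : Function.Exact ι π) (hπ : Function.Surjective π)
    (hcenter : ∀ (y : I) (x : L), ι y * x = 0) :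
    ∃ BI : Leibniz.Bimodule F Q I,
      (∀ (x : L) (y : I), ι (BI.left (π x) y) = x * ι y) ∧
      (∀ (x : L) (y : I), ι (BI.right (π x) y) = ι y * x) ∧
      BI.IsAntisymmetric ∧
      ∀ (M : Type uM) [AddCommGroup M] [Module F M] (B : Leibniz.Bimodule F Q M),
        ∃ E : E₂CohomologicalSpectralSequenceNat (ModuleCat.{max uL uM} F),
          Leibniz.ConvergesTo E (Leibniz.relHL B π) ∧
          (∀ p : ℕ, Nonempty ((E.page 2 le_rfl).X (p, 0) ≃ₗ[F]
            Leibniz.HL (BI.toLeftModule.hom (Leibniz.HLzeroLeftModule B π hπ)).symm p)) ∧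
          (∀ p q : ℕ, 1 ≤ q → Nonempty ((E.page 2 le_rfl).X (p, q) ≃ₗ[F]
            (Leibniz.HLhomology BI.toLeftModule p →ₗ[F] Leibniz.HL (B.comap π) q))) := by
  obtain ⟨BI, s, τ, hanti, h⟩ := Leibniz.exists_kernel_bimodule ι π hι hex hπ hcenter
  refine ⟨BI, h.ι_left, fun x y => ?_, hanti, fun M _ _ B =>
    ⟨(Leibniz.relFiltered (h.isNegligible (B := B))).spectralSequence,
      Leibniz.relFiltered_convergesTo h, Leibniz.relFiltered_page_two_zero h hπ B,
      fun p q hq => ?_⟩⟩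
  · rw [hanti, map_zero, hcenter]
  · obtain ⟨q, rfl⟩ := Nat.exists_eq_succ_of_ne_zero (by lia : q ≠ 0)
    exact Leibniz.relFiltered_page_two_succ h B p q
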